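/- **Setting.** Let $\mathcal A$ be a unital $*$-algebra over $\mathbb C$ and $\tau:\mathcal A\to\mathbb C$ a linear functional with $\tau(1)=1$ and $\tau(xy)=\tau(yx)$. A *tracial weight* $\omega$ on a $*$-algebra is a linear functional on a (not necessarily unital) $*$-subalgebra $D(\omega)$ that satisfies $\omega(xy)=\omega(yx)$, $\omega(x^*)=\overline{\omega(x)}$ and $\omega(x^*x)\ge 0$ for all $x,y\in D(\omega)$. A tuple $(x_1,\dots,x_n)$ in $D(\omega)$ is *trace class* with respect to $\omega$ if there are trace class operators $X_1,\dots,X_n$ on a separable complex Hilbert space $H$ such that $\omega(x_{i_1}^{\epsilon_1}\cdots x_{i_m}^{\epsilon_m})=\operatorname{Tr}_H(X_{i_1}^{\epsilon_1}\cdots X_{i_m}^{\epsilon_m})$ for all $m\ge 1$, all indices $i_1,\dots,i_m$ and all $\epsilon_1,\dots,\epsilon_m\in\{1,*\}$. For a single trace class element $x$, $\operatorname{EV}(x)$ is the multiset of nonzero eigenvalues, with multiplicity, of such an operator $X$. For a multiset $M$ of nonzero numbers, $cM$ is the multiset of the nonzero numbers among $c\lambda$, $\lambda\in M$ (so $0M=\emptyset$),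 and $\sqcup$ adds multiplicities. Let $\omega$ be a tracial weight on $\mathcal A$, let $a,a_1,\dots,a_k\in D(\omega)$ be such that $(a,a_1,\dots,a_k)$ is trace class with respect to $\omega$, and let $b,b_1,\dots,b_k\in\mathcal A$. Let $\mathcal A_0$ be the (non-unital) $*$-subalgebra generated by $a,a_1,\dots,a_k$, let $\mathcal B_0$ be the unital $*$-subalgebra generated by $b,b_1,\dots,b_k$, and let $I$ be the linear span of all $y_0x_1y_1\cdots x_ny_n$ with $n\ge1$, $x_i\in\mathcal A_0$, $y_i\in\mathcal B_0$. Assume that the pair $(\{a,a_1,\dots,a_k\},\{b,b_1,\dots,b_k\})$ is *cyclically monotone* with respect to $(\omega,\tau)$, i.e. $I\subset D(\omega)$ and $$\omega(x_1y_1x_2y_2\cdots x_ny_n)=\omega(x_1x_2\cdots x_n)\,\tau(y_1)\tau(y_2)\cdots\tau(y_n)\qquad(n\ge1,\ x_i\in\mathcal A_0,\ y_i\in\mathcal B_0).$$ **Theorem.** 1. Suppose that $a_1,\dots,a_k$ are selfadjoint and that $\omega(xy)=\omega(yx)$ for all $x\in I$, $y\in\mathcal B_0$. Let $B=(\tau(b_i^*b_j))_{i,j=1}^k$.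 Then $\sum_i b_ia_ib_i^*$ is trace class with respect to $\omega$, $\sqrt B\operatorname{diag}(a_1,\dots,a_k)\sqrt B$ is trace class with respect to the tracial weight $\operatorname{Tr}_k\otimes\,\omega$ on $M_k(\mathbb C)\otimes\mathcal A$ (with domain $M_k(D(\omega))$), and $$\operatorname{EV}\Big(\sum_{i=1}^k b_ia_ib_i^*\Big)=\operatorname{EV}\big(\sqrt B\operatorname{diag}(a_1,\dots,a_k)\sqrt B\big).$$ 2. If $b_1,\dots,b_k$ are selfadjoint, then $\sum_i a_ib_ia_i^*$ and $\sum_i\tau(b_i)a_ia_i^*$ are trace class with respect to $\omega$ and $$\operatorname{EV}\Big(\sum_{i=1}^k a_ib_ia_i^*\Big)=\operatorname{EV}\Big(\sum_{i=1}^k\tau(b_i)a_ia_i^*\Big).$$ 3. If $a,b$ are selfadjoint, $p=\sqrt{\tau(b^2)}+\tau(b)$ and $q=-\sqrt{\tau(b^2)}+\tau(b)$, then $ab+ba$ is trace class with respect to $\omega$ and $$\operatorname{EV}(ab+ba)=p\operatorname{EV}(a)\sqcup q\operatorname{EV}(a).$$ 4. If $a,b$ are selfadjoint and $r=\sqrt{\tau(b^2)-\tau(b)^2}$,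 then $\mathrm i(ab-ba)$ is trace class with respect to $\omega$ and $$\operatorname{EV}(\mathrm i(ab-ba))=r\operatorname{EV}(a)\sqcup(-r)\operatorname{EV}(a).$$ (Unless $a,a_1,\dots,a_k$ all have zero distribution, the hypotheses force $B$ to be positive semidefinite and, when $b$ is selfadjoint, $\tau(b^2)\ge\tau(b)^2\ge0$ with $\tau(b)$ real, and $\sqrt{\ }$ denotes the usual nonnegative square root. In the exceptional case all the multisets above are empty and the formulas hold for any choice of the square roots.) -/

import Mathlib

open scoped ComplexOrder MatrixOrder Matrix.Norms.L2Operator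

noncomputable section

namespace CyclicMonotone

/-! ### Tracial weights -/

/-- A tracial weight on a `*`-algebra `A` over `ℂ`: a linear functional on a (not necessarily
unital) `*`-subalgebra `D(ω)` which is tracial, selfadjoint and positive. -/
structure TracialWeight (A : Type*) [Ring A] [StarRing A] [Algebra ℂ A] [StarModule ℂ A] where
  /-- the domain `D(ω)` -/
  domain : NonUnitalStarSubalgebra ℂ A
  /-- the functional `ω : D(ω) → ℂ` -/
  map : domain →ₗ[ℂ] ℂ
  tracial : ∀ x y : domain, map (x * y) = map (y * x)
  selfadjoint : ∀ x : domain, map (star x) = star (map x)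
  positive : ∀ x : domain, 0 ≤ map (star x * x)

section Matrices

set_option linter.unusedSectionVars false

variable {A : Type*} [Ring A] [StarRing A] [Algebra ℂ A] [StarModule ℂ A]

/-- The `*`-subalgebra `M_k(D)` of `M_k(A)`: matrices with all entries in `D`. -/
def matrixDomain (D : NonUnitalStarSubalgebra ℂ A) (k : ℕ) :
    NonUnitalStarSubalgebra ℂ (Matrix (Fin k) (Fin k) A) where
  carrier := {M | ∀ i j, M i j ∈ D}
  add_mem' hM hN i j := D.add_mem (hM i j) (hN i j)
  zero_mem' _ _ := D.zero_mem
  mul_mem' {M N} hM hN i j := by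
    rw [Matrix.mul_apply]
    exact sum_mem fun l _ => D.mul_mem (hM i l) (hN l j)
  smul_mem' c M hM i j := SMulMemClass.smul_mem c (hM i j)
  star_mem' {M} hM i j := by
    rw [Matrix.star_apply]
    exact star_mem (hM j i)

/-- The entry `(i, j)` of a matrix in `M_k(D)`, as an element of `D`. -/
def matrixEntry (D : NonUnitalStarSubalgebra ℂ A) {k : ℕ} (M : matrixDomain D k)
    (i j : Fin k) : D :=
  ⟨M.1 i j, (show ∀ i j, M.1 i j ∈ D from M.2) i j⟩

theorem matrixEntry_mul (D : NonUnitalStarSubalgebra ℂ A) {k : ℕ} (M N : matrixDomain D k)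
    (i j : Fin k) :
    matrixEntry D (M * N) i j = ∑ l, matrixEntry D M i l * matrixEntry D N l j := by
  apply Subtype.ext
  rw [AddSubmonoidClass.coe_finsetSum]
  exact Matrix.mul_apply

theorem matrixEntry_star (D : NonUnitalStarSubalgebra ℂ A) {k : ℕ} (M : matrixDomain D k)
    (i j : Fin k) :
    matrixEntry D (star M) i j = star (matrixEntry D M j i) :=
  rfl

/-- The tracial weight `Tr_k ⊗ ω` on `M_k(ℂ) ⊗ A = M_k(A)`, with domain `M_k(D(ω))`. -/
def TracialWeight.matrix (ω : TracialWeight A) (k : ℕ) :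
    TracialWeight (Matrix (Fin k) (Fin k) A) where
  domain := matrixDomain ω.domain k
  map :=
    { toFun := fun M => ∑ i, ω.map (matrixEntry ω.domain M i i)
      map_add' := fun M N => by
        rw [← Finset.sum_add_distrib]
        exact Finset.sum_congr rfl fun i _ => map_add ω.map (matrixEntry _ M i i) (matrixEntry _ N i i)
      map_smul' := fun c M => by
        rw [Finset.smul_sum]
        exact Finset.sum_congr rfl fun i _ => map_smul ω.map c (matrixEntry _ M i i) }
  tracial M N := by
    simp only [LinearMap.coe_mk, AddHom.coe_mk, matrixEntry_mul, map_sum]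
    rw [Finset.sum_comm]
    exact Finset.sum_congr rfl fun i _ => Finset.sum_congr rfl fun j _ => ω.tracial _ _
  selfadjoint M := by
    simp only [LinearMap.coe_mk, AddHom.coe_mk, matrixEntry_star, ω.selfadjoint, star_sum]
  positive M := by
    simp only [LinearMap.coe_mk, AddHom.coe_mk, matrixEntry_mul, map_sum, matrixEntry_star]
    exact Finset.sum_nonneg fun i _ => Finset.sum_nonneg fun j _ => ω.positive _

end Matrices

/-! ### Trace class operators and their eigenvalues -/

section Operators

variable {H : Type*} [NormedAddCommGroup H] [InnerProductSpace ℂ H]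

/-- `x` is a trace class operator on a Hilbert space (in the form: `x` is nuclear), i.e.
`x h = ∑ₙ ⟨uₙ, h⟩ vₙ` for vectors with `∑ₙ ‖uₙ‖ ‖vₙ‖ < ∞`. -/
def IsTraceClassOperator (x : H →L[ℂ] H) : Prop :=
  ∃ u v : ℕ → H, (Summable fun n => ‖u n‖ * ‖v n‖) ∧
    ∀ h : H, HasSum (fun n => inner ℂ (u n) h • v n) (x h)

/-- The trace `Tr_H x = ∑ᵢ ⟨eᵢ, x eᵢ⟩`, computed in some orthonormal basis `(eᵢ)` of `H`
(for trace class `x` the series converges absolutely and its sum does not depend on the basis). -/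
def operatorTrace [CompleteSpace H] (x : H →L[ℂ] H) : ℂ :=
  ∑' i : (exists_hilbertBasis ℂ H).choose, inner ℂ (i : H) (x (i : H))

/-- The multiset of nonzero eigenvalues of `x`, counted with (algebraic) multiplicity, encoded by
its multiplicity function; the eigenvalue `0` is not recorded. -/
def operatorEV (x : H →L[ℂ] H) : ℂ → ℕ∞ := fun μ =>
  if μ = 0 then 0
  else Cardinal.toENat
    (Module.rank ℂ (Module.End.maxGenEigenspace (x : H →ₗ[ℂ] H) μ))

end Operators

/-- For a multiset `m` of nonzero complex numbers (given by its multiplicity function), the multiset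
of the nonzero ones among the numbers `c λ`, `λ ∈ m`. The union `⊔` of two multisets is
the pointwise sum `+` of multiplicity functions. -/
def scaleEV (c : ℂ) (m : ℂ → ℕ∞) : ℂ → ℕ∞ := fun μ =>
  if c = 0 ∨ μ = 0 then 0 else m (μ / c)

/-! ### Distributions, trace class elements and their eigenvalues -/

/-- The product `a_{i₁}^{ε₁} ⋯ a_{i_m}^{ε_m}`, `m ≥ 1`, for a nonempty word
`(i₁, ε₁), …, (i_m, ε_m)`; here `ε = true` stands for `*` and `ε = false` for `1`. -/
def starWord {ι S : Type*} [Semigroup S] [Star S] (a : ι → S)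
    (w : FreeSemigroup (ι × Bool)) : S :=
  FreeSemigroup.lift (fun p : ι × Bool => if p.2 then star (a p.1) else a p.1) w

section Elements

variable {A : Type*} [Ring A] [StarRing A] [Algebra ℂ A] [StarModule ℂ A]

/-- A realization of the family `(a_i)` of elements of `D(ω)` by trace class operators `x_i` on a
separable Hilbert space `H`: the distribution of `(a_i)` with respect to `ω` is that of
`(x_i)` with respect to `Tr_H`. -/
structure TraceClassModel (ω : TracialWeight A) {ι : Type} (a : ι → A) where
  mem : ∀ i, a i ∈ ω.domain
  H : Type
  [normed : NormedAddCommGroup H]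
  [innerProduct : InnerProductSpace ℂ H]
  [complete : CompleteSpace H]
  [separable : TopologicalSpace.SeparableSpace H]
  x : ι → H →L[ℂ] H
  traceClass : ∀ i, IsTraceClassOperator (x i)
  same_distribution : ∀ w : FreeSemigroup (ι × Bool),
    ω.map (starWord (fun i => (⟨a i, mem i⟩ : ω.domain)) w) = operatorTrace (starWord x w)

attribute [instance] TraceClassModel.normed TraceClassModel.innerProduct TraceClassModel.complete
  TraceClassModel.separable

/-- The family `(a_i)` lies in `D(ω)` and is trace class with respect to `ω`. -/
def IsTraceClassFamily (ω : TracialWeight A) {ι : Type} (a : ι → A) : Prop :=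
  Nonempty (TraceClassModel ω a)

/-- A single element that lies in `D(ω)` and is trace class with respect to `ω`. -/
def IsTraceClass (ω : TracialWeight A) (a : A) : Prop :=
  IsTraceClassFamily ω fun _ : Unit => a

open Classical in
/-- `EV(a)`: the multiset of nonzero eigenvalues of a trace class operator on a separable Hilbert
space with the same distribution as `a` (only meaningful if `a` is trace class). -/
def EV (ω : TracialWeight A) (a : A) : ℂ → ℕ∞ :=
  if h : Nonempty (TraceClassModel ω fun _ : Unit => a) then operatorEV (h.some.x ()) else 0

/-! ### Cyclic monotone independence -/

/-- `I_B(A) = span {b₀ a₁ b₁ ⋯ aₙ bₙ : n ≥ 1, aᵢ ∈ A, bᵢ ∈ B}`. -/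
def mixedIdeal (𝒜 : NonUnitalStarSubalgebra ℂ A) (ℬ : StarSubalgebra ℂ A) : Submodule ℂ A :=
  Submodule.span ℂ {z | ∃ (n : ℕ) (a : Fin (n + 1) → A) (b₀ : A) (b : Fin (n + 1) → A),
    (∀ i, a i ∈ 𝒜) ∧ b₀ ∈ ℬ ∧ (∀ i, b i ∈ ℬ) ∧
      z = b₀ * (List.ofFn fun i => a i * b i).prod}

/-- The pair `(A, B)` of `*`-subalgebras (`B` containing the unit) is cyclically monotonically
independent with respect to `(ω, τ)`. By the first clause, both arguments of `ω`
in the second clause do lie in `D(ω)`. -/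
def IsCyclicallyMonotone (ω : TracialWeight A) (τ : A →ₗ[ℂ] ℂ)
    (𝒜 : NonUnitalStarSubalgebra ℂ A) (ℬ : StarSubalgebra ℂ A) : Prop :=
  (∀ z ∈ mixedIdeal 𝒜 ℬ, z ∈ ω.domain) ∧
  ∀ (n : ℕ) (a b : Fin (n + 1) → A), (∀ i, a i ∈ 𝒜) → (∀ i, b i ∈ ℬ) →
    ∀ (h₁ : (List.ofFn fun i => a i * b i).prod ∈ ω.domain)
      (h₂ : (List.ofFn a).prod ∈ ω.domain),
      ω.map ⟨_, h₁⟩ = ω.map ⟨_, h₂⟩ * ∏ i, τ (b i)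

/-- `ω(x y) = ω(y x)` for `x ∈ I_B(A)` and `y ∈ B` (both products lie in `I_B(A)`). -/
def IsTracialOver (ω : TracialWeight A)
    (𝒜 : NonUnitalStarSubalgebra ℂ A) (ℬ : StarSubalgebra ℂ A) : Prop :=
  ∀ x ∈ mixedIdeal 𝒜 ℬ, ∀ y ∈ ℬ, ∀ (h₁ : x * y ∈ ω.domain) (h₂ : y * x ∈ ω.domain),
    ω.map ⟨x * y, h₁⟩ = ω.map ⟨y * x, h₂⟩

/-- The matrix `√B diag(a₁, …, a_k) √B ∈ M_k(ℂ) ⊗ A` for a complex matrix `B`. -/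
def sandwich {k : ℕ} (B : Matrix (Fin k) (Fin k) ℂ) (a : Fin k → A) :
    Matrix (Fin k) (Fin k) A :=
  (CFC.sqrt B).map (algebraMap ℂ A) * Matrix.diagonal a * (CFC.sqrt B).map (algebraMap ℂ A)

end Elements

end CyclicMonotone

end

/-! The proof follows pairs `(z, Z)`, an element of `A` together with an operator that imitates it.
Let `Xᵢ` be the trace class operators modelling the given family, and let `S` be the `*`-algebra
generated by the pairs `(aᵢ, Xᵢ)`. Having the same distribution means that `ω(z) = Tr Z` on `S`.
Cyclic monotonicity extends this identity to the algebra generated by the pairs `(x y, τ(y) X)`,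
with `(x, X)` in `S` and `y` in `ℬ`: each factor from `ℬ` may be replaced by its expectation
(`mem_of_mem_mixedPairs`).

Each selfadjoint element in the theorem thus has the moments of an explicit selfadjoint trace class
operator. For `∑ uᵢ xᵢ vᵢ`, regrouping a power puts the products `vᵢ uⱼ` inside, and the moments
become those of the operator matrix `(τ(vᵢ uⱼ) Xᵢ)` (`extend_pow_sum_conj`). With `u = b`, `v = b*`
this matrix is `diag(X) B`, which has the same moments as `√B diag(X) √B`. For the commutator and
the anticommutator it is `C ⊗ X` with a scalar 2×2 matrix `C`, whose eigenvalues are the two scaling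
factors. For `∑ aᵢ bᵢ aᵢ*` the replacement is direct.

Moments suffice: the numbers `Tr(Xⁿ)`, `n ≥ 1`, determine the nonzero eigenvalues of a selfadjoint
trace class operator with their multiplicities (`operatorEV_eq_add`), and selfadjointness is itself
visible in the `*`-moments, so `EV` does not depend on the model chosen (`operatorEV_congr`).

Positivity of `B` and reality of the scaling factors come from positivity of `ω`: as soon as some
`Xⱼ ≠ 0`, the identity `ω(x* y* y x) = τ(y* y) Tr(X* X)` makes `τ` positive on `ℬ`. If all the
relevant operators vanish, both sides of each formula are empty. -/

noncomputable section

namespace CyclicMonotone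

open Filter Topology

set_option linter.unusedSectionVars false

/-! ### Traces of nuclear operators -/

section Trace

variable {H : Type*} [NormedAddCommGroup H] [InnerProductSpace ℂ H]

/-- `x h = ∑ₙ ⟨uₙ, h⟩ vₙ` is a nuclear operator and `t = ∑ₙ ⟨uₙ, vₙ⟩`. -/
def HasTrace (x : H →L[ℂ] H) (t : ℂ) : Prop :=
  ∃ u v : ℕ → H, (Summable fun n => ‖u n‖ * ‖v n‖) ∧
    (∀ h : H, HasSum (fun n => inner ℂ (u n) h • v n) (x h)) ∧
    HasSum (fun n => inner ℂ (u n) (v n)) t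

theorem summable_inner_of_summable_norm {u v : ℕ → H} (h : Summable fun n => ‖u n‖ * ‖v n‖) :
    Summable fun n => inner ℂ (u n) (v n) :=
  Summable.of_norm_bounded h fun n => norm_inner_le_norm (u n) (v n)

theorem IsTraceClassOperator.exists_hasTrace {x : H →L[ℂ] H} (hx : IsTraceClassOperator x) :
    ∃ t, HasTrace x t := by
  obtain ⟨u, v, h, h'⟩ := hx
  exact ⟨_, u, v, h, h', (summable_inner_of_summable_norm h).hasSum⟩

theorem HasTrace.isTraceClassOperator {x : H →L[ℂ] H} {t : ℂ} (hx : HasTrace x t) :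
    IsTraceClassOperator x := by
  obtain ⟨u, v, h, h', -⟩ := hx
  exact ⟨u, v, h, h'⟩

/-- Cauchy–Schwarz, then Bessel's inequality for `u` and for `v`. The bound is uniform in `s`, so it
gives absolute convergence of the double series behind the trace. -/
theorem sum_norm_inner_mul_norm_inner_le {ι : Type*} {b : ι → H} (hb : Orthonormal ℂ b)
    (u v : H) (s : Finset ι) :
    ∑ i ∈ s, ‖inner ℂ u (b i) * inner ℂ (b i) v‖ ≤ ‖u‖ * ‖v‖ := by
  have hu := hb.sum_inner_products_le (x := u) (s := s)
  have hv := hb.sum_inner_products_le (x := v) (s := s)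
  simp only [norm_mul]
  refine abs_le_of_sq_le_sq' ?_ (by positivity) |>.2
  calc (∑ i ∈ s, ‖inner ℂ u (b i)‖ * ‖inner ℂ (b i) v‖) ^ 2
      ≤ (∑ i ∈ s, ‖inner ℂ u (b i)‖ ^ 2) * ∑ i ∈ s, ‖inner ℂ (b i) v‖ ^ 2 :=
        Finset.sum_mul_sq_le_sq_mul_sq _ _ _
    _ ≤ ‖u‖ ^ 2 * ‖v‖ ^ 2 := by
        have hu' : ∑ i ∈ s, ‖inner ℂ u (b i)‖ ^ 2 ≤ ‖u‖ ^ 2 := by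
          simpa only [norm_inner_symm u] using hu
        gcongr
    _ = (‖u‖ * ‖v‖) ^ 2 := by ring

/-- The double series of `⟨uₙ, bᵢ⟩⟨bᵢ, vₙ⟩` converges absolutely. Summing over `i` first gives `∑
⟨uₙ, vₙ⟩` by Parseval, summing over `n` first gives the diagonal of `x`. Hence the trace depends
neither on the basis nor on the nuclear representation. -/
theorem HasTrace.hasSum_inner {x : H →L[ℂ] H} {t : ℂ} (hx : HasTrace x t) {ι : Type*}
    (b : HilbertBasis ι ℂ H) : HasSum (fun i => inner ℂ (b i) (x (b i))) t := by
  obtain ⟨u, v, h, h', ht⟩ := hx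
  let f : ℕ × ι → ℂ := fun p => inner ℂ (u p.1) (b p.2) * inner ℂ (b p.2) (v p.1)
  have hbd := fun n => sum_norm_inner_mul_norm_inner_le b.orthonormal (u n) (v n)
  have hsn : ∀ n, Summable fun i => ‖f (n, i)‖ := fun n =>
    summable_of_sum_le (fun i => norm_nonneg _) (hbd n)
  have hf : Summable f := by
    refine Summable.of_norm ((summable_prod_of_nonneg fun p => norm_nonneg (f p)).2 ⟨hsn, ?_⟩)
    exact Summable.of_nonneg_of_le (fun n => tsum_nonneg fun i => norm_nonneg _)
      (fun n => Real.tsum_le_of_sum_le (fun i => norm_nonneg _) (hbd n)) h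
  have h1 : HasSum f t := by
    have := hf.hasSum.prod_fiberwise fun n => b.hasSum_inner_mul_inner (u n) (v n)
    rw [← this.unique ht]
    exact hf.hasSum
  have h2 : HasSum (fun p : ι × ℕ => f p.swap) t := (Equiv.prodComm ι ℕ).hasSum_iff.2 h1
  refine h2.prod_fiberwise fun i => ?_
  have := (h' (b i)).mapL (innerSL ℂ (b i))
  simpa [f, inner_smul_right] using this

theorem HasTrace.operatorTrace_eq [CompleteSpace H] {x : H →L[ℂ] H} {t : ℂ}
    (hx : HasTrace x t) : operatorTrace x = t := by
  obtain ⟨b, hb⟩ := (exists_hilbertBasis ℂ H).choose_spec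
  rw [operatorTrace, ← (hx.hasSum_inner b).tsum_eq, hb]

theorem IsTraceClassOperator.hasTrace [CompleteSpace H] {x : H →L[ℂ] H}
    (hx : IsTraceClassOperator x) : HasTrace x (operatorTrace x) := by
  obtain ⟨t, ht⟩ := hx.exists_hasTrace
  rwa [ht.operatorTrace_eq]

theorem hasTrace_zero : HasTrace (0 : H →L[ℂ] H) 0 :=
  ⟨0, 0, by simp, fun h => by simp, by simp⟩

theorem HasTrace.smul {x : H →L[ℂ] H} {t : ℂ} (hx : HasTrace x t) (c : ℂ) :
    HasTrace (c • x) (c * t) := by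
  obtain ⟨u, v, h, h', ht⟩ := hx
  refine ⟨u, fun n => c • v n, ?_, fun w => ?_, ?_⟩
  · simpa only [norm_smul, mul_left_comm] using h.mul_left ‖c‖
  · simpa only [smul_comm c] using! (h' w).const_smul c
  · simpa only [inner_smul_right] using ht.mul_left c

theorem HasTrace.add {x y : H →L[ℂ] H} {s t : ℂ} (hx : HasTrace x s) (hy : HasTrace y t) :
    HasTrace (x + y) (s + t) := by
  obtain ⟨u, v, h, h', hs⟩ := hx
  obtain ⟨u₁, v₁, h₁, h₁', ht⟩ := hy
  refine ⟨Sum.elim u u₁ ∘ Equiv.natSumNatEquivNat.symm,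
    Sum.elim v v₁ ∘ Equiv.natSumNatEquivNat.symm, ?_, fun w => ?_, ?_⟩
  · refine Equiv.natSumNatEquivNat.symm.summable_iff
      (f := fun i => ‖Sum.elim u u₁ i‖ * ‖Sum.elim v v₁ i‖) |>.2 (Summable.sum _ ?_ ?_)
    exacts [h, h₁]
  · refine Equiv.natSumNatEquivNat.symm.hasSum_iff
      (f := fun i => inner ℂ (Sum.elim u u₁ i) w • Sum.elim v v₁ i) |>.2 (HasSum.sum ?_ ?_)
    exacts [h' w, h₁' w]
  · refine Equiv.natSumNatEquivNat.symm.hasSum_iff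
      (f := fun i => inner ℂ (Sum.elim u u₁ i) (Sum.elim v v₁ i)) |>.2 (HasSum.sum ?_ ?_)
    exacts [hs, ht]

theorem HasTrace.sum {ι : Type*} (s : Finset ι) {x : ι → H →L[ℂ] H} {t : ι → ℂ}
    (h : ∀ i ∈ s, HasTrace (x i) (t i)) : HasTrace (∑ i ∈ s, x i) (∑ i ∈ s, t i) := by
  classical
  induction s using Finset.induction_on with
  | empty => simpa using hasTrace_zero
  | insert a s ha ih =>
    rw [Finset.sum_insert ha, Finset.sum_insert ha]
    exact (h a (by simp)).add (ih fun i hi => h i (by simp [hi]))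

variable [CompleteSpace H] {K : Type*} [NormedAddCommGroup K] [InnerProductSpace ℂ K]
  [CompleteSpace K]

/-- Cyclicity of the trace, for a nuclear operator `x` and bounded operators `P`, `Q`. -/
theorem IsTraceClassOperator.exists_hasTrace_comp {x : H →L[ℂ] H} (hx : IsTraceClassOperator x)
    (P : H →L[ℂ] K) (Q : K →L[ℂ] H) :
    ∃ t, HasTrace (P ∘L x ∘L Q) t ∧ HasTrace ((Q ∘L P) * x) t := by
  obtain ⟨u, v, h, h'⟩ := hx
  have hs : Summable fun n => ‖u n‖ * ‖Q (P (v n))‖ := by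
    refine Summable.of_nonneg_of_le (fun n => by positivity) (fun n => ?_)
      (h.mul_left ‖Q ∘L P‖)
    rw [mul_left_comm]
    gcongr
    exact (Q ∘L P).le_opNorm (v n)
  -- `P x Q` is represented by `(Q* uₙ, P vₙ)` and `Q P x` by `(uₙ, Q P vₙ)`; both trace series are
  -- `∑ ⟨uₙ, Q P vₙ⟩`.
  refine ⟨_, ⟨fun n => Q.adjoint (u n), fun n => P (v n), ?_, fun w => ?_, ?_⟩,
    ⟨u, fun n => Q (P (v n)), hs, fun w => ?_, (summable_inner_of_summable_norm hs).hasSum⟩⟩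
  · refine Summable.of_nonneg_of_le (fun n => by positivity) (fun n => ?_)
      (h.mul_left (‖Q.adjoint‖ * ‖P‖))
    rw [mul_mul_mul_comm]
    gcongr
    exacts [Q.adjoint.le_opNorm _, P.le_opNorm _]
  · simpa [ContinuousLinearMap.adjoint_inner_left] using (h' (Q w)).mapL P
  · simpa only [ContinuousLinearMap.adjoint_inner_left] using
      (summable_inner_of_summable_norm hs).hasSum
  · simpa using (h' w).mapL (Q ∘L P)

theorem IsTraceClassOperator.mul_left {x : H →L[ℂ] H} (hx : IsTraceClassOperator x)
    (y : H →L[ℂ] H) : IsTraceClassOperator (y * x) := by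
  obtain ⟨t, -, h⟩ := hx.exists_hasTrace_comp y 1
  exact h.isTraceClassOperator

theorem IsTraceClassOperator.smul {x : H →L[ℂ] H} (hx : IsTraceClassOperator x) (c : ℂ) :
    IsTraceClassOperator (c • x) := (hx.hasTrace.smul c).isTraceClassOperator

theorem IsTraceClassOperator.star {x : H →L[ℂ] H} (hx : IsTraceClassOperator x) :
    IsTraceClassOperator (star x) := by
  obtain ⟨u, v, h, h'⟩ := hx
  refine ⟨v, u, by simpa only [mul_comm] using h, fun w => ?_⟩
  have hs : Summable fun n => inner ℂ (v n) w • u n := by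
    refine Summable.of_norm_bounded (h.mul_left ‖w‖) fun n => ?_
    rw [norm_smul]
    calc ‖inner ℂ (v n) w‖ * ‖u n‖ ≤ (‖v n‖ * ‖w‖) * ‖u n‖ := by
          gcongr
          exact norm_inner_le_norm _ _
      _ = ‖w‖ * (‖u n‖ * ‖v n‖) := by ring
  convert hs.hasSum using 1
  refine ext_inner_left ℂ fun z => ?_
  rw [ContinuousLinearMap.star_eq_adjoint, ContinuousLinearMap.adjoint_inner_right]
  have h1 := hs.hasSum.mapL (innerSL ℂ z)
  have h2 := (h' z).mapL (innerSL ℂ w)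
  have h3 := HasSum.star h2
  simp only [innerSL_apply_apply, inner_smul_right] at h1 h3
  simp only [RCLike.star_def, map_mul, inner_conj_symm] at h3
  have h4 : ∀ n, inner ℂ (v n) w * inner ℂ z (u n) = inner ℂ z (u n) * inner ℂ (v n) w :=
    fun n => mul_comm _ _
  simp only [h4] at h1
  exact h3.unique h1

theorem operatorTrace_zero : operatorTrace (0 : H →L[ℂ] H) = 0 :=
  hasTrace_zero.operatorTrace_eq

theorem operatorTrace_smul {x : H →L[ℂ] H} (hx : IsTraceClassOperator x) (c : ℂ) :
    operatorTrace (c • x) = c * operatorTrace x :=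
  (hx.hasTrace.smul c).operatorTrace_eq

theorem operatorTrace_sum {ι : Type*} (s : Finset ι) {x : ι → H →L[ℂ] H}
    (h : ∀ i ∈ s, IsTraceClassOperator (x i)) :
    operatorTrace (∑ i ∈ s, x i) = ∑ i ∈ s, operatorTrace (x i) :=
  (HasTrace.sum s fun i hi => (h i hi).hasTrace).operatorTrace_eq

theorem isTraceClassOperator_sum {ι : Type*} (s : Finset ι) {x : ι → H →L[ℂ] H}
    (h : ∀ i ∈ s, IsTraceClassOperator (x i)) : IsTraceClassOperator (∑ i ∈ s, x i) :=
  (HasTrace.sum s fun i hi => (h i hi).hasTrace).isTraceClassOperator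

/-- `Tr(x* x)` is a nonnegative number that vanishes only for `x = 0`. -/
theorem operatorTrace_star_mul_self {x : H →L[ℂ] H} (hx : IsTraceClassOperator x) :
    0 ≤ operatorTrace (star x * x) ∧ (operatorTrace (star x * x) = 0 → x = 0) := by
  obtain ⟨w, b, -⟩ := exists_hilbertBasis ℂ H
  have h := (hx.mul_left (Star.star x)).hasTrace.hasSum_inner b
  have hb : ∀ i, inner ℂ (b i) ((Star.star x * x) (b i)) = ((‖x (b i)‖ ^ 2 : ℝ) : ℂ) := by
    intro i
    rw [mul_apply_eq_comp, ContinuousLinearMap.star_eq_adjoint,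
      ContinuousLinearMap.adjoint_inner_right, inner_self_eq_norm_sq_to_K]
    simp
  simp only [hb] at h
  refine ⟨h.nonneg fun i => by exact_mod_cast sq_nonneg ‖x (b i)‖, fun h0 => ?_⟩
  rw [h0] at h
  have h' : HasSum (fun i => ‖x (b i)‖ ^ 2) 0 := Complex.hasSum_ofReal.1 (by simpa using h)
  have hz := (hasSum_zero_iff_of_nonneg fun i => sq_nonneg _).1 h'
  refine ContinuousLinearMap.ext fun v => ?_
  have hv := (b.hasSum_repr v).mapL x
  refine hv.unique ?_
  have : ∀ i, x (b i) = 0 := fun i => by simpa using congrFun hz i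
  simp [this]

end Trace

/-! ### Multiplicities are determined by moments -/

section Moments

open Polynomial

variable {ι : Type*} {l : ι → ℝ} {m : ℕ → ℝ}

theorem hasSum_mul_eval (h : ∀ k, HasSum (fun i => l i ^ (k + 1)) (m k)) (q : ℝ[X]) :
    HasSum (fun i => l i * q.eval (l i)) (q.sum fun k c => c * m k) := by
  simp only [Polynomial.eval_eq_sum, Polynomial.sum_def, Finset.mul_sum]
  refine hasSum_sum fun k _ => ?_
  simpa only [pow_succ', mul_left_comm] using (h k).mul_left (q.coeff k)

/-- For `|μ|, |t| ≤ R`, the values `t * countingPolynomial μ R n t` converge to `1` if `t = μ`, and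
to `0` otherwise. -/
def countingPolynomial (μ R : ℝ) (n : ℕ) : ℝ[X] :=
  C (1 / μ ^ 2) * X * (1 - (C (1 / (2 * R)) * (X - C μ)) ^ 2) ^ n

theorem eval_countingPolynomial (μ R : ℝ) (n : ℕ) (t : ℝ) :
    t * (countingPolynomial μ R n).eval t =
      t ^ 2 / μ ^ 2 * (1 - ((t - μ) / (2 * R)) ^ 2) ^ n := by
  simp only [countingPolynomial, eval_mul, eval_C, eval_X, eval_pow, eval_sub, eval_one]
  ring

theorem finite_setOf_eq_of_summable (hl : Summable l) {μ : ℝ} (hμ : μ ≠ 0) :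
    {i | l i = μ}.Finite := by
  have h := hl.tendsto_cofinite_zero.eventually_ne hμ.symm
  simpa [Filter.eventually_cofinite] using h

/-- Dominated convergence. Since `|t - μ| ≤ 2R`, the base of the `n`-th power lies in `[0, 1]` and
equals `1` only at `t = μ`. The factor `t² / μ²` normalises the value at `μ` and yields the summable
bound `|t| R / μ²`. -/
theorem tendsto_sum_countingPolynomial (h : ∀ k, HasSum (fun i => l i ^ (k + 1)) (m k))
    {μ R : ℝ} (hμ : μ ≠ 0) (hR : |μ| ≤ R) (hlR : ∀ i, |l i| ≤ R) :
    Tendsto (fun n => (countingPolynomial μ R n).sum fun k c => c * m k) atTop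
      (𝓝 ({i | l i = μ}.ncard : ℝ)) := by
  classical
  have hl : Summable l := by simpa using (h 0).summable
  have hR0 : 0 < R := (abs_pos.2 hμ).trans_le hR
  have hfin := finite_setOf_eq_of_summable hl hμ
  have hcount : HasSum (fun i => if l i = μ then (1 : ℝ) else 0) ({i | l i = μ}.ncard : ℝ) := by
    have : HasSum (fun i => if l i = μ then (1 : ℝ) else 0)
        (∑ i ∈ hfin.toFinset, if l i = μ then (1 : ℝ) else 0) :=
      hasSum_sum_of_ne_finset_zero fun i hi => if_neg (by simpa using hi)
    rwa [Finset.sum_congr rfl (g := fun _ => (1 : ℝ)) fun i hi => if_pos (by simpa using hi),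
      Finset.sum_const, nsmul_one, ← Set.ncard_eq_toFinset_card _ hfin] at this
  have hs : ∀ i, 0 ≤ 1 - ((l i - μ) / (2 * R)) ^ 2 ∧ 1 - ((l i - μ) / (2 * R)) ^ 2 ≤ 1 ∧
      (l i ≠ μ → 1 - ((l i - μ) / (2 * R)) ^ 2 < 1) := by
    intro i
    have h1 : |(l i - μ) / (2 * R)| ≤ 1 := by
      rw [abs_div, abs_of_pos (by positivity : 0 < 2 * R), div_le_one (by positivity)]
      linarith [abs_sub (l i) μ, hlR i]
    have h2 : ((l i - μ) / (2 * R)) ^ 2 ≤ 1 := (sq_le_one_iff_abs_le_one _).2 h1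
    refine ⟨by linarith, by linarith [sq_nonneg ((l i - μ) / (2 * R))], fun hne => ?_⟩
    have : 0 < ((l i - μ) / (2 * R)) ^ 2 := by
      have : (l i - μ) / (2 * R) ≠ 0 := div_ne_zero (sub_ne_zero.2 hne) (by positivity)
      positivity
    linarith
  have key := tendsto_tsum_of_dominated_convergence (𝓕 := atTop)
    (f := fun (n : ℕ) i => l i * (countingPolynomial μ R n).eval (l i))
    (g := fun i => if l i = μ then (1 : ℝ) else 0) (bound := fun i => |l i| * (R / μ ^ 2))
    (hl.abs.mul_right _) (fun i => ?_) (.of_forall fun n i => ?_)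
  · rw [hcount.tsum_eq] at key
    exact key.congr fun n => (hasSum_mul_eval h _).tsum_eq
  · simp only [eval_countingPolynomial]
    split_ifs with hi
    · simp [hi, hμ]
    · simpa using (tendsto_pow_atTop_nhds_zero_of_lt_one (hs i).1 ((hs i).2.2 hi)).const_mul
        (l i ^ 2 / μ ^ 2)
  · rw [eval_countingPolynomial, Real.norm_eq_abs, abs_mul, abs_pow, abs_of_nonneg (hs i).1,
      abs_of_nonneg (by positivity : 0 ≤ l i ^ 2 / μ ^ 2)]
    calc l i ^ 2 / μ ^ 2 * (1 - ((l i - μ) / (2 * R)) ^ 2) ^ n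
        ≤ l i ^ 2 / μ ^ 2 * 1 := by
          gcongr
          exact pow_le_one₀ (hs i).1 (hs i).2.1
      _ = |l i| * (|l i| / μ ^ 2) := by rw [← sq_abs]; ring
      _ ≤ |l i| * (R / μ ^ 2) := by gcongr; exact hlR i

theorem exists_abs_le_of_summable (hl : Summable l) : ∃ R, ∀ i, |l i| ≤ R :=
  ⟨∑' i, |l i|, fun i => hl.abs.le_tsum i fun _ _ => abs_nonneg _⟩

/-- The counting limits involve only the moments, linearly. A common bound `S` allows the same
polynomials for all three families. -/
theorem ncard_setOf_eq_of_moments {ι₁ ι₂ : Type*} {l₁ : ι₁ → ℝ} {l₂ : ι₂ → ℝ} {m₁ m₂ : ℕ → ℝ}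
    (h : ∀ k, HasSum (fun i => l i ^ (k + 1)) (m k))
    (h₁ : ∀ k, HasSum (fun i => l₁ i ^ (k + 1)) (m₁ k))
    (h₂ : ∀ k, HasSum (fun i => l₂ i ^ (k + 1)) (m₂ k))
    (hm : ∀ k, m k = m₁ k + m₂ k) {μ : ℝ} (hμ : μ ≠ 0) :
    {i | l i = μ}.ncard = {i | l₁ i = μ}.ncard + {i | l₂ i = μ}.ncard := by
  obtain ⟨R, hR⟩ := exists_abs_le_of_summable (l := l) (by simpa using (h 0).summable)
  obtain ⟨R₁, hR₁⟩ := exists_abs_le_of_summable (l := l₁) (by simpa using (h₁ 0).summable)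
  obtain ⟨R₂, hR₂⟩ := exists_abs_le_of_summable (l := l₂) (by simpa using (h₂ 0).summable)
  let S := max (max R |μ|) (max R₁ R₂)
  have t := tendsto_sum_countingPolynomial h (R := S) hμ (by simp [S])
    fun i => (hR i).trans (by simp [S])
  have t₁ := tendsto_sum_countingPolynomial h₁ (R := S) hμ (by simp [S])
    fun i => (hR₁ i).trans (by simp [S])
  have t₂ := tendsto_sum_countingPolynomial h₂ (R := S) hμ (by simp [S])
    fun i => (hR₂ i).trans (by simp [S])
  have := tendsto_nhds_unique t ((t₁.add t₂).congr fun n => ?_)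
  · exact_mod_cast this
  · simp only [Polynomial.sum_def, ← Finset.sum_add_distrib, hm, mul_add]

end Moments

/-! ### Eigenbases of selfadjoint trace class operators -/

section Spectral

universe u

variable {H : Type u} [NormedAddCommGroup H] [InnerProductSpace ℂ H] [CompleteSpace H]

/-- The nuclear series converges in operator norm, so `x` is a norm limit of finite rank operators.
-/
theorem IsTraceClassOperator.isCompactOperator {x : H →L[ℂ] H} (hx : IsTraceClassOperator x) :
    IsCompactOperator x := by
  obtain ⟨u, v, h, h'⟩ := hx
  have hs : Summable fun n => InnerProductSpace.rankOne ℂ (v n) (u n) :=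
    Summable.of_norm (by simpa only [InnerProductSpace.norm_rankOne, mul_comm] using h)
  have hx : x = ∑' n, InnerProductSpace.rankOne ℂ (v n) (u n) := by
    refine ContinuousLinearMap.ext fun w => (h' w).unique ?_
    simpa using hs.hasSum.mapL (ContinuousLinearMap.apply ℂ H w)
  have hsum : HasSum (fun n => InnerProductSpace.rankOne ℂ (v n) (u n)) x := hx ▸ hs.hasSum
  refine isCompactOperator_of_tendsto hsum.tendsto_sum_nat (.of_forall fun n => ?_)
  refine (compactOperator (RingHom.id ℂ) H H).sum_mem fun i _ => ?_
  exact (isCompactOperator_of_locallyCompactSpace_rng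
    (ContinuousLinearMap.toSpanSingleton ℂ (v i))).comp_clm (innerSL ℂ (u i))

/-- Hilbert bases of the eigenspaces are put together; the spectral theorem for compact symmetric
operators shows that nothing is orthogonal to all of them. -/
theorem exists_eigenbasis {x : H →L[ℂ] H} (hx : IsTraceClassOperator x) (hsa : IsSelfAdjoint x) :
    ∃ (ι : Type u) (b : HilbertBasis ι ℂ H) (l : ι → ℝ), ∀ i, x (b i) = (l i : ℂ) • b i := by
  have hsym := hsa.isSymmetric
  have hcl : ∀ μ : ℂ, CompleteSpace (Module.End.eigenspace (x : H →ₗ[ℂ] H) μ) := by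
    intro μ
    have : (Module.End.eigenspace (x : H →ₗ[ℂ] H) μ : Set H) =
        (LinearMap.ker ((x - μ • (1 : H →L[ℂ] H) : H →L[ℂ] H) : H →ₗ[ℂ] H) : Set H) := by
      ext w
      simp [sub_eq_zero]
    refine IsClosed.completeSpace_coe (hs := ?_)
    rw [this]
    exact ContinuousLinearMap.isClosed_ker _
  choose w b hb using fun μ : ℂ => exists_hilbertBasis ℂ (Module.End.eigenspace (x : H →ₗ[ℂ] H) μ)
  have hv := hsym.orthogonalFamily_eigenspaces.orthonormal_sigma_orthonormal
    fun μ => (b μ).orthonormal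
  have hsp : (Submodule.span ℂ (Set.range fun a : Σ μ, w μ =>
      (Module.End.eigenspace (x : H →ₗ[ℂ] H) a.1).subtypeₗᵢ (b a.1 a.2)))ᗮ = ⊥ := by
    rw [eq_bot_iff, ← x.orthogonalComplement_iSup_eigenspaces_eq_bot hx.isCompactOperator hsym]
    intro y hy
    rw [← Submodule.iInf_orthogonal, Submodule.mem_iInf]
    refine fun μ => (Submodule.mem_orthogonal _ _).2 fun z hz => ?_
    have h1 := ((b μ).hasSum_repr ⟨z, hz⟩).mapL
      ((innerSL ℂ y).comp (Module.End.eigenspace (x : H →ₗ[ℂ] H) μ).subtypeL)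
    have h2 : ∀ i, inner ℂ y ((b μ i : H)) = 0 := fun i =>
      inner_eq_zero_symm.1 ((Submodule.mem_orthogonal _ _).1 hy _
        (Submodule.subset_span ⟨⟨μ, i⟩, rfl⟩))
    refine inner_eq_zero_symm.1 (h1.unique ?_)
    simp [h2]
  refine ⟨_, HilbertBasis.mkOfOrthogonalEqBot hv hsp, fun a => a.1.re, fun a => ?_⟩
  rw [HilbertBasis.coe_mkOfOrthogonalEqBot]
  have h1 := Module.End.mem_eigenspace_iff.1 (b a.1 a.2).2
  have hne : (b a.1 a.2 : H) ≠ 0 := by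
    have := (b a.1).orthonormal.ne_zero a.2
    simpa using this
  have h2 : (starRingEnd ℂ) a.1 = a.1 :=
    hsym.conj_eigenvalue_eq_self (Module.End.hasEigenvalue_of_hasEigenvector ⟨(b a.1 a.2).2, hne⟩)
  rw [Complex.conj_eq_iff_re.1 h2]
  exact h1

variable {x : H →L[ℂ] H} {ι : Type*} {b : HilbertBasis ι ℂ H} {l : ι → ℝ}

theorem hasSum_pow_of_eigenbasis (hx : IsTraceClassOperator x)
    (hb : ∀ i, x (b i) = (l i : ℂ) • b i) (k : ℕ) :
    HasSum (fun i => l i ^ (k + 1)) (operatorTrace (x ^ (k + 1))).re := by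
  have h := (pow_succ x k ▸ hx.mul_left (x ^ k)).hasTrace.hasSum_inner b
  have hp : ∀ (n : ℕ) i, (x ^ n) (b i) = ((l i ^ n : ℝ) : ℂ) • b i := by
    intro n i
    induction n with
    | zero => simp
    | succ n ih =>
      rw [pow_succ, mul_apply_eq_comp, hb, map_smul, ih, smul_smul, pow_succ, mul_comm]
      push_cast
      rfl
  have hn : ∀ i, inner ℂ (b i) (b i) = (1 : ℂ) := fun i => by
    simp [inner_self_eq_norm_sq_to_K, b.orthonormal.1 i]
  simp only [hp, inner_smul_right, hn, mul_one] at h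
  simpa only [Complex.reCLM_apply, Complex.ofReal_re] using Complex.reCLM.hasSum h

/-- In the eigenbasis, `(x - μ)ⁿ` multiplies the `i`-th coordinate by `(lᵢ - μ)ⁿ`. So there are no
Jordan blocks, and the generalized eigenspace is spanned by the finitely many `bᵢ` with `lᵢ = μ`. -/
theorem operatorEV_of_eigenbasis (hx : IsTraceClassOperator x) (hsa : IsSelfAdjoint x)
    (hb : ∀ i, x (b i) = (l i : ℂ) • b i) {μ : ℝ} (hμ : μ ≠ 0) :
    operatorEV x μ = ({i | l i = μ}.ncard : ℕ∞) := by
  have hfin : {i | l i = μ}.Finite := finite_setOf_eq_of_summable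
    (by simpa using (hasSum_pow_of_eigenbasis hx hb 0).summable) hμ
  have hli : LinearIndependent ℂ fun i : {i | l i = μ} => b i :=
    b.orthonormal.linearIndependent.comp _ Subtype.val_injective
  have hcoord : ∀ (n : ℕ) i (w : H), inner ℂ (b i)
      ((((x : H →ₗ[ℂ] H) - (μ : ℂ) • (1 : Module.End ℂ H)) ^ n) w) =
        ((l i : ℂ) - μ) ^ n * inner ℂ (b i) w := by
    intro n i
    induction n with
    | zero => simp
    | succ n ih =>
      intro w
      have hsw : inner ℂ (b i) (x w) = (l i : ℂ) * inner ℂ (b i) w := by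
        rw [← hsa.isSymmetric.apply_clm, hb, inner_smul_left, Complex.conj_ofReal]
      rw [pow_succ, Module.End.mul_apply, ih, LinearMap.sub_apply, inner_sub_right,
        LinearMap.smul_apply, Module.End.one_apply, inner_smul_right,
        ContinuousLinearMap.coe_coe, hsw]
      ring
  have hspan : Module.End.maxGenEigenspace (x : H →ₗ[ℂ] H) (μ : ℂ) =
      Submodule.span ℂ (Set.range fun i : {i | l i = μ} => b i) := by
    refine le_antisymm (fun w hw => ?_) (Submodule.span_le.2 ?_)
    · obtain ⟨n, hn⟩ := Module.End.mem_maxGenEigenspace _ _ _ |>.1 hw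
      have hz : ∀ i, l i ≠ μ → inner ℂ (b i) w = 0 := by
        intro i hi
        have h1 := hcoord n i w
        rw [hn, inner_zero_right] at h1
        refine (mul_eq_zero.1 h1.symm).resolve_left (pow_ne_zero _ (sub_ne_zero.2 ?_))
        exact_mod_cast hi
      have h1 : w = ∑ i ∈ hfin.toFinset, inner ℂ (b i) w • b i := by
        have h2 := b.hasSum_repr w
        simp only [b.repr_apply_apply] at h2
        refine h2.unique (hasSum_sum_of_ne_finset_zero fun i hi => ?_)
        rw [hz i (by simpa using hi), zero_smul]
      rw [h1]
      exact Submodule.sum_mem _ fun i hi => Submodule.smul_mem _ _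
        (Submodule.subset_span ⟨⟨i, by simpa using hi⟩, rfl⟩)
    · rintro _ ⟨⟨i, hi⟩, rfl⟩
      refine Module.End.eigenspace_le_maxGenEigenspace (Module.End.mem_eigenspace_iff.2 ?_)
      have hi' : l i = μ := hi
      simpa [hi'] using hb i
  rw [operatorEV, if_neg (by exact_mod_cast hμ), hspan, rank_span hli,
    hfin.cast_ncard_eq]
  change (Set.range _).encard = _
  rw [← Set.image_univ, hli.injective.encard_image, Set.encard_univ]
  rfl

/-- A selfadjoint trace class operator has only real eigenvalues. -/
theorem operatorEV_eq_zero_of_not_real (hsa : IsSelfAdjoint x) {μ : ℂ} (hμ : (μ.re : ℂ) ≠ μ) :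
    operatorEV x μ = 0 := by
  have h : Module.End.maxGenEigenspace (x : H →ₗ[ℂ] H) μ = ⊥ := by
    by_contra hne
    have h1 : Module.End.HasEigenvalue (x : H →ₗ[ℂ] H) μ := by
      rw [Module.End.hasEigenvalue_iff]
      intro h0
      apply hne
      rw [eq_bot_iff]
      intro w hw
      obtain ⟨n, hn⟩ := Module.End.mem_maxGenEigenspace _ _ _ |>.1 hw
      -- Without eigenvectors `x - μ` is injective, hence so are its powers.
      have hinj : Function.Injective ((x : H →ₗ[ℂ] H) - μ • (1 : Module.End ℂ H)) := by
        rw [← LinearMap.ker_eq_bot, ← h0, Module.End.eigenspace_def]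
      have := (hinj.iterate n)
      rw [← Module.End.coe_pow] at this
      exact this (hn.trans (map_zero _).symm)
    exact hμ (Complex.conj_eq_iff_re.1 (hsa.isSymmetric.conj_eigenvalue_eq_self h1))
  rw [operatorEV, h]
  simp

/-- Two selfadjoint trace class operators have, jointly, the nonzero eigenvalues of a third one as
soon as the traces of powers match. -/
theorem operatorEV_eq_add {H₁ H₂ : Type*} [NormedAddCommGroup H₁] [InnerProductSpace ℂ H₁]
    [CompleteSpace H₁] [NormedAddCommGroup H₂] [InnerProductSpace ℂ H₂] [CompleteSpace H₂]
    {x₁ : H₁ →L[ℂ] H₁} {x₂ : H₂ →L[ℂ] H₂} (hx : IsTraceClassOperator x) (hsa : IsSelfAdjoint x)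
    (hx₁ : IsTraceClassOperator x₁) (hsa₁ : IsSelfAdjoint x₁)
    (hx₂ : IsTraceClassOperator x₂) (hsa₂ : IsSelfAdjoint x₂)
    (h : ∀ k, operatorTrace (x ^ (k + 1)) =
      operatorTrace (x₁ ^ (k + 1)) + operatorTrace (x₂ ^ (k + 1))) :
    operatorEV x = operatorEV x₁ + operatorEV x₂ := by
  funext μ
  rw [Pi.add_apply]
  by_cases hμ : (μ.re : ℂ) = μ
  · rw [← hμ]
    by_cases h0 : μ.re = 0
    · simp [h0, operatorEV]
    obtain ⟨_, b, l, hb⟩ := exists_eigenbasis hx hsa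
    obtain ⟨_, b₁, l₁, hb₁⟩ := exists_eigenbasis hx₁ hsa₁
    obtain ⟨_, b₂, l₂, hb₂⟩ := exists_eigenbasis hx₂ hsa₂
    rw [operatorEV_of_eigenbasis hx hsa hb h0, operatorEV_of_eigenbasis hx₁ hsa₁ hb₁ h0,
      operatorEV_of_eigenbasis hx₂ hsa₂ hb₂ h0,
      ncard_setOf_eq_of_moments (hasSum_pow_of_eigenbasis hx hb)
        (hasSum_pow_of_eigenbasis hx₁ hb₁) (hasSum_pow_of_eigenbasis hx₂ hb₂)
        (fun k => by rw [h k, Complex.add_re]) h0]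
    push_cast
    rfl
  · rw [operatorEV_eq_zero_of_not_real hsa hμ, operatorEV_eq_zero_of_not_real hsa₁ hμ,
      operatorEV_eq_zero_of_not_real hsa₂ hμ, add_zero]

end Spectral

/-! ### Eigenvalues of scalar multiples. -/

section Scaling

variable {H : Type*} [NormedAddCommGroup H] [InnerProductSpace ℂ H]

theorem operatorEV_zero : operatorEV (0 : H →L[ℂ] H) = 0 := by
  funext μ
  by_cases hμ : μ = 0
  · simp [operatorEV, hμ]
  · have : Module.End.maxGenEigenspace ((0 : H →L[ℂ] H) : H →ₗ[ℂ] H) μ = ⊥ := by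
      rw [eq_bot_iff]
      intro w hw
      obtain ⟨n, hn⟩ := Module.End.mem_maxGenEigenspace _ _ _ |>.1 hw
      have h1 : ((0 : H →L[ℂ] H) : H →ₗ[ℂ] H) - μ • (1 : Module.End ℂ H) =
          (-μ) • (1 : Module.End ℂ H) := by simp
      rw [h1, smul_pow, one_pow] at hn
      simpa [hμ] using hn
    rw [operatorEV, this]
    simp

theorem operatorEV_smul (c : ℂ) (x : H →L[ℂ] H) :
    operatorEV (c • x) = scaleEV c (operatorEV x) := by
  funext μ
  rw [scaleEV]
  split_ifs with hc
  · rcases hc with rfl | rfl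
    · rw [zero_smul, operatorEV_zero, Pi.zero_apply]
    · simp [operatorEV]
  · rw [not_or] at hc
    rw [operatorEV, operatorEV, if_neg hc.2, if_neg (div_ne_zero hc.2 hc.1)]
    have : Module.End.maxGenEigenspace ((c • x : H →L[ℂ] H) : H →ₗ[ℂ] H) μ =
        Module.End.maxGenEigenspace (x : H →ₗ[ℂ] H) (μ / c) := by
      ext w
      rw [Module.End.mem_maxGenEigenspace, Module.End.mem_maxGenEigenspace]
      refine exists_congr fun n => ?_
      have h1 : ((c • x : H →L[ℂ] H) : H →ₗ[ℂ] H) - μ • (1 : Module.End ℂ H) =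
          c • ((x : H →ₗ[ℂ] H) - (μ / c) • (1 : Module.End ℂ H)) := by
        rw [smul_sub, smul_smul, mul_div_cancel₀ _ hc.1]
        rfl
      rw [h1, smul_pow, LinearMap.smul_apply, smul_eq_zero_iff_right (pow_ne_zero n hc.1)]
    rw [this]

end Scaling

/-! ### Matrices of operators -/

section Block

variable {H : Type*} [NormedAddCommGroup H] [InnerProductSpace ℂ H] {k : ℕ}

/-- The operator on `H ⊕ ⋯ ⊕ H` given by a matrix of operators on `H`. -/
def blockOperator [CompleteSpace H] (M : Matrix (Fin k) (Fin k) (H →L[ℂ] H)) :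
    PiLp 2 (fun _ : Fin k => H) →L[ℂ] PiLp 2 (fun _ : Fin k => H) :=
  ∑ i, ∑ j, (PiLp.proj 2 (fun _ : Fin k => H) i : _ →L[ℂ] H).adjoint ∘L M i j ∘L
    (PiLp.proj 2 (fun _ : Fin k => H) j : _ →L[ℂ] H)

variable [CompleteSpace H]

theorem adjoint_proj_apply (i j : Fin k) (h : H) :
    (PiLp.proj 2 (fun _ : Fin k => H) i : _ →L[ℂ] H).adjoint h j = if i = j then h else 0 := by
  have : (PiLp.proj 2 (fun _ : Fin k => H) i : _ →L[ℂ] H).adjoint h =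
      WithLp.toLp 2 (Pi.single i h) := by
    refine ext_inner_left ℂ fun z => ?_
    rw [ContinuousLinearMap.adjoint_inner_right, PiLp.inner_apply, Finset.sum_eq_single i]
    · simp
    · intro l _ hl
      simp [Pi.single_eq_of_ne hl]
    · simp
  rw [this]
  simp [Pi.single_apply, eq_comm]

theorem blockOperator_apply (M : Matrix (Fin k) (Fin k) (H →L[ℂ] H))
    (f : PiLp 2 (fun _ : Fin k => H)) (i : Fin k) :
    blockOperator M f i = ∑ j, M i j (f j) := by
  simp only [blockOperator, sum_apply, WithLp.ofLp_sum, Finset.sum_apply,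
    ContinuousLinearMap.comp_apply, adjoint_proj_apply, PiLp.proj_apply]
  rw [Finset.sum_comm]
  simp

theorem blockOperator_mul (M N : Matrix (Fin k) (Fin k) (H →L[ℂ] H)) :
    blockOperator (M * N) = blockOperator M * blockOperator N := by
  ext f i
  simp only [blockOperator_apply, mul_apply_eq_comp, Matrix.mul_apply, map_sum,
    sum_apply]
  rw [Finset.sum_comm]

theorem blockOperator_pow_succ (M : Matrix (Fin k) (Fin k) (H →L[ℂ] H)) (n : ℕ) :
    blockOperator (M ^ (n + 1)) = blockOperator M ^ (n + 1) := by
  induction n with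
  | zero => simp
  | succ n ih => rw [pow_succ, blockOperator_mul, ih, pow_succ _ (n + 1)]

theorem isSelfAdjoint_blockOperator {M : Matrix (Fin k) (Fin k) (H →L[ℂ] H)}
    (hM : ∀ i j, star (M j i) = M i j) : IsSelfAdjoint (blockOperator M) := by
  rw [ContinuousLinearMap.isSelfAdjoint_iff_isSymmetric]
  intro f g
  simp only [ContinuousLinearMap.coe_coe, PiLp.inner_apply, blockOperator_apply, sum_inner,
    inner_sum]
  rw [Finset.sum_comm]
  refine Finset.sum_congr rfl fun i _ => Finset.sum_congr rfl fun j _ => ?_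
  rw [← hM i j, ContinuousLinearMap.star_eq_adjoint, ContinuousLinearMap.adjoint_inner_right]

/-- With `Pᵢ` the coordinate projections, cyclicity turns the trace of `Pᵢ* Mᵢⱼ Pⱼ` into that of `Pⱼ
Pᵢ* Mᵢⱼ`, and `Pⱼ Pᵢ*` is `1` or `0`. -/
theorem hasTrace_blockOperator {M : Matrix (Fin k) (Fin k) (H →L[ℂ] H)}
    (hM : ∀ i j, IsTraceClassOperator (M i j)) :
    HasTrace (blockOperator M) (∑ i, operatorTrace (M i i)) := by
  have key : ∀ i j, HasTrace ((PiLp.proj 2 (fun _ : Fin k => H) i : _ →L[ℂ] H).adjoint ∘L M i j ∘L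
      (PiLp.proj 2 (fun _ : Fin k => H) j : _ →L[ℂ] H))
      (if i = j then operatorTrace (M i j) else 0) := by
    intro i j
    obtain ⟨t, h₁, h₂⟩ := (hM i j).exists_hasTrace_comp
      (PiLp.proj 2 (fun _ : Fin k => H) i : _ →L[ℂ] H).adjoint
      (PiLp.proj 2 (fun _ : Fin k => H) j : _ →L[ℂ] H)
    have h₃ : (PiLp.proj 2 (fun _ : Fin k => H) j : _ →L[ℂ] H) ∘L
        (PiLp.proj 2 (fun _ : Fin k => H) i : _ →L[ℂ] H).adjoint = if i = j then 1 else 0 := by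
      ext h
      split_ifs with hij <;> simp [adjoint_proj_apply, hij]
    rw [h₃] at h₂
    convert h₁
    rw [← h₂.operatorTrace_eq]
    split_ifs <;> simp [operatorTrace_zero]
  have := HasTrace.sum Finset.univ fun i _ => HasTrace.sum Finset.univ fun j _ => key i j
  simpa [blockOperator] using this

end Block

/-! ### Models -/

section Models

theorem starWord_of {ι S : Type*} [Semigroup S] [Star S] (a : ι → S) (p : ι × Bool) :
    starWord a (.of p) = if p.2 then star (a p.1) else a p.1 := rfl

theorem starWord_mul {ι S : Type*} [Semigroup S] [Star S] (a : ι → S)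
    (v w : FreeSemigroup (ι × Bool)) : starWord a (v * w) = starWord a v * starWord a w :=
  map_mul _ v w

theorem starWord_eq_pow {S : Type*} [Monoid S] [Star S] {a : S} (ha : star a = a)
    (w : FreeSemigroup (Unit × Bool)) : starWord (fun _ => a) w = a ^ w.length := by
  induction w with
  | ih1 p => simp [starWord_of, ha]
  | ih2 p w ihp ihw => rw [starWord_mul, ihp, ihw, FreeSemigroup.length_mul, pow_add]

theorem starWord_mem {ι S T : Type*} [Semigroup S] [Star S] [SetLike T S] [MulMemClass T S]
    [StarMemClass T S] (D : T) {a : ι → S} (ha : ∀ i, a i ∈ D) (w : FreeSemigroup (ι × Bool)) :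
    starWord a w ∈ D := by
  induction w with
  | ih1 p => rw [starWord_of]; split_ifs; exacts [star_mem (ha _), ha _]
  | ih2 p w ihp ihw => rw [starWord_mul]; exact mul_mem ihp ihw

/-- Only `*`-moments of `z` occur on the right, so the distribution of `z` decides whether `z` is
selfadjoint. -/
theorem operatorTrace_star_sub_mul_sub {E : Type*} [NormedAddCommGroup E] [InnerProductSpace ℂ E]
    [CompleteSpace E] {z : E →L[ℂ] E} (hz : IsTraceClassOperator z) :
    operatorTrace (star (z - star z) * (z - star z)) =
      operatorTrace (starWord (fun _ : Unit => z) (.of ((), true) * .of ((), false))) +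
      (-1) * operatorTrace (starWord (fun _ : Unit => z) (.of ((), true) * .of ((), true))) +
      (-1) * operatorTrace (starWord (fun _ : Unit => z) (.of ((), false) * .of ((), false))) +
      operatorTrace (starWord (fun _ : Unit => z) (.of ((), false) * .of ((), true))) := by
  have e : star (z - star z) * (z - star z) =
      star z * z + (-1 : ℂ) • (star z * star z) + (-1 : ℂ) • (z * z) + z * star z := by
    rw [star_sub, star_star, neg_one_smul, neg_one_smul]
    noncomm_ring
  have h1 := hz.mul_left (star z)
  have h2 := hz.star.mul_left (star z)
  have h3 := hz.mul_left z
  have h4 := hz.star.mul_left z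
  rw [e, ((((h1.hasTrace).add (h2.hasTrace.smul _)).add (h3.hasTrace.smul _)).add
    h4.hasTrace).operatorTrace_eq]
  rfl

/-- Equal `*`-moments transfer selfadjointness from `y` to `x`; after that, equality of the power
traces is enough. -/
theorem operatorEV_congr {H K : Type*} [NormedAddCommGroup H] [InnerProductSpace ℂ H]
    [CompleteSpace H] [NormedAddCommGroup K] [InnerProductSpace ℂ K] [CompleteSpace K]
    {x : H →L[ℂ] H} {y : K →L[ℂ] K} (hx : IsTraceClassOperator x) (hy : IsTraceClassOperator y)
    (hsa : IsSelfAdjoint y)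
    (h : ∀ w, operatorTrace (starWord (fun _ : Unit => x) w) =
      operatorTrace (starWord (fun _ : Unit => y) w)) :
    operatorEV x = operatorEV y := by
  have hstar : star x = x := by
    have h1 := operatorTrace_star_sub_mul_sub hy
    rw [hsa.star_eq, sub_self, mul_zero, operatorTrace_zero, ← h, ← h, ← h, ← h,
      ← operatorTrace_star_sub_mul_sub hx] at h1
    have htc : IsTraceClassOperator (x - star x) := by
      simpa [sub_eq_add_neg] using (hx.hasTrace.add (hx.star.smul (-1)).hasTrace).isTraceClassOperator
    exact (sub_eq_zero.1 ((operatorTrace_star_mul_self htc).2 h1.symm)).symm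
  have := operatorEV_eq_add (x₂ := (0 : K →L[ℂ] K)) hx hstar hy hsa
    hasTrace_zero.isTraceClassOperator (.zero _) fun n => ?_
  · rw [this, operatorEV_zero, add_zero]
  · have h1 := h ⟨((), false), List.replicate n ((), false)⟩
    rw [starWord_eq_pow hstar, starWord_eq_pow hsa] at h1
    simpa [FreeSemigroup.length, operatorTrace_zero] using h1

variable {A : Type*} [Ring A] [StarRing A] [Algebra ℂ A] [StarModule ℂ A]

theorem coe_starWord {ι : Type*} (D : NonUnitalStarSubalgebra ℂ A) {a : ι → A} (ha : ∀ i, a i ∈ D)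
    (w : FreeSemigroup (ι × Bool)) :
    ((starWord (fun i => (⟨a i, ha i⟩ : D)) w : D) : A) = starWord a w := by
  induction w with
  | ih1 p => simp only [starWord_of]; split_ifs <;> rfl
  | ih2 p w ihp ihw => rw [starWord_mul, starWord_mul, ← ihp, ← ihw]; rfl

/-- An extension of the functional `ω : D(ω) → ℂ` to the whole algebra. -/
theorem TracialWeight.exists_extend (ω : TracialWeight A) :
    ∃ Ω : A →ₗ[ℂ] ℂ, ∀ z (hz : z ∈ ω.domain), Ω z = ω.map ⟨z, hz⟩ := by
  obtain ⟨g, hg⟩ := LinearMap.exists_extend (p := ω.domain.toSubmodule) ω.map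
  exact ⟨g, fun z hz => LinearMap.congr_fun hg ⟨z, hz⟩⟩

variable {ω : TracialWeight A} {Ω : A →ₗ[ℂ] ℂ}
  {K : Type} [NormedAddCommGroup K] [InnerProductSpace ℂ K] [CompleteSpace K]
  [TopologicalSpace.SeparableSpace K] {y : A} {Y : K →L[ℂ] K}

/-- `EV` is computed in an arbitrarily chosen model; any explicit selfadjoint model `Y` gives the
same multiset. -/
theorem isTraceClass_and_EV_eq (hΩ : ∀ z (hz : z ∈ ω.domain), Ω z = ω.map ⟨z, hz⟩)
    (hy : y ∈ ω.domain) (hY : IsTraceClassOperator Y)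
    (hsa : IsSelfAdjoint Y)
    (h : ∀ w, Ω (starWord (fun _ : Unit => y) w) = operatorTrace (starWord (fun _ : Unit => Y) w)) :
    IsTraceClass ω y ∧ EV ω y = operatorEV Y := by
  have hw : ∀ (hm : ∀ _ : Unit, y ∈ ω.domain) (w : FreeSemigroup (Unit × Bool)),
      ω.map (starWord (fun i => (⟨y, hm i⟩ : ω.domain)) w) =
        operatorTrace (starWord (fun _ : Unit => Y) w) := by
    intro hm w
    rw [← h w, ← coe_starWord ω.domain hm, hΩ _ (SetLike.coe_mem _)]
  have hne : IsTraceClass ω y :=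
    ⟨{ mem := fun _ => hy, H := K, x := fun _ => Y, traceClass := fun _ => hY,
       same_distribution := hw _ }⟩
  refine ⟨hne, ?_⟩
  have hne' : Nonempty (TraceClassModel ω fun _ : Unit => y) := hne
  rw [EV, dif_pos hne']
  exact operatorEV_congr (hne'.some.traceClass ()) hY hsa fun w =>
    (hne'.some.same_distribution w).symm.trans (hw _ w)

theorem isTraceClass_and_EV_eq_of_isSelfAdjoint (hΩ : ∀ z (hz : z ∈ ω.domain), Ω z = ω.map ⟨z, hz⟩)
    (hy : y ∈ ω.domain) (hysa : IsSelfAdjoint y)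
    (hY : IsTraceClassOperator Y) (hsa : IsSelfAdjoint Y)
    (h : ∀ n, Ω (y ^ (n + 1)) = operatorTrace (Y ^ (n + 1))) :
    IsTraceClass ω y ∧ EV ω y = operatorEV Y :=
  isTraceClass_and_EV_eq hΩ hy hY hsa fun w => by
    rw [starWord_eq_pow hysa, starWord_eq_pow hsa]
    exact h _

end Models

/-! ### Pairs of elements with the same distribution -/

section Pairs

variable {A : Type*} [Ring A] [StarRing A] [Algebra ℂ A]
  {H : Type*} [NormedAddCommGroup H] [InnerProductSpace ℂ H] [CompleteSpace H]

theorem starWord_prod {ι : Type*} (c : ι → A) (x : ι → H →L[ℂ] H) (w : FreeSemigroup (ι × Bool)) :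
    starWord (fun i => (c i, x i)) w = (starWord c w, starWord x w) := by
  induction w with
  | ih1 p => simp only [starWord_of]; split_ifs <;> rfl
  | ih2 p w ihp ihw => simp only [starWord_mul, ihp, ihw, Prod.mk_mul_mk]

theorem isTraceClassOperator_starWord {ι : Type*} {x : ι → H →L[ℂ] H}
    (hx : ∀ i, IsTraceClassOperator (x i)) (w : FreeSemigroup (ι × Bool)) :
    IsTraceClassOperator (starWord x w) := by
  induction w with
  | ih1 p => rw [starWord_of]; split_ifs; exacts [(hx _).star, hx _]
  | ih2 p w ihp ihw => rw [starWord_mul]; exact ihw.mul_left _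

/-- The pairs `(z, Z)` with `Z` of trace class and `Ω z = Tr Z`. -/
def traceGraph (Ω : A →ₗ[ℂ] ℂ) (H : Type*) [NormedAddCommGroup H] [InnerProductSpace ℂ H]
    [CompleteSpace H] : Submodule ℂ (A × (H →L[ℂ] H)) where
  carrier := {p | IsTraceClassOperator p.2 ∧ Ω p.1 = operatorTrace p.2}
  add_mem' {p q} hp hq := by
    have := hp.1.hasTrace.add hq.1.hasTrace
    exact ⟨this.isTraceClassOperator, by
      rw [Prod.fst_add, map_add, hp.2, hq.2, Prod.snd_add, this.operatorTrace_eq]⟩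
  zero_mem' := ⟨hasTrace_zero.isTraceClassOperator, by
    rw [Prod.fst_zero, map_zero, Prod.snd_zero, operatorTrace_zero]⟩
  smul_mem' c p hp := ⟨hp.1.smul c, by
    rw [Prod.smul_fst, map_smul, hp.2, Prod.smul_snd, operatorTrace_smul hp.1, smul_eq_mul]⟩

variable [StarModule ℂ A]

/-- The `*`-algebra generated by the pairs `(cᵢ, xᵢ)`. -/
def pairAlgebra {ι : Type*} (c : ι → A) (x : ι → H →L[ℂ] H) :
    NonUnitalStarSubalgebra ℂ (A × (H →L[ℂ] H)) :=
  NonUnitalStarAlgebra.adjoin ℂ (Set.range fun i => (c i, x i))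

/-- The generated `*`-algebra is the linear span of the `*`-words in the generators, and membership
in `traceGraph` is a linear condition. -/
theorem pairAlgebra_le_traceGraph {ι : Type*} {c : ι → A} {x : ι → H →L[ℂ] H}
    (hx : ∀ i, IsTraceClassOperator (x i)) {Ω : A →ₗ[ℂ] ℂ}
    (h : ∀ w : FreeSemigroup (ι × Bool), Ω (starWord c w) = operatorTrace (starWord x w)) :
    ∀ p ∈ pairAlgebra c x, p ∈ traceGraph Ω H := by
  intro p hp
  have hp' : p ∈ (pairAlgebra c x).toSubmodule := hp
  rw [pairAlgebra, NonUnitalStarAlgebra.adjoin_eq_span] at hp'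
  refine Submodule.span_le.2 ?_ hp'
  intro q hq
  have : ∃ w, q = starWord (fun i => (c i, x i)) w := by
    induction hq using Subsemigroup.closure_induction with
    | mem q hq =>
      rcases hq with ⟨i, rfl⟩ | ⟨i, hi⟩
      · exact ⟨.of (i, false), rfl⟩
      · exact ⟨.of (i, true), by rw [starWord_of]; simp [hi]⟩
    | mul q r _ _ hq hr =>
      obtain ⟨v, rfl⟩ := hq
      obtain ⟨w, rfl⟩ := hr
      exact ⟨v * w, (starWord_mul _ _ _).symm⟩
  obtain ⟨w, rfl⟩ := this
  rw [starWord_prod]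
  exact ⟨isTraceClassOperator_starWord hx w, h w⟩

theorem fst_mem_of_mem_pairAlgebra {ι : Type*} {c : ι → A} {x : ι → H →L[ℂ] H}
    {𝒜 : NonUnitalStarSubalgebra ℂ A} (hc : ∀ i, c i ∈ 𝒜) :
    ∀ p ∈ pairAlgebra c x, p.1 ∈ 𝒜 := by
  have : pairAlgebra c x ≤ 𝒜.comap (NonUnitalStarAlgHom.fst ℂ A (H →L[ℂ] H)) := by
    refine NonUnitalStarAlgebra.adjoin_le ?_
    rintro _ ⟨i, rfl⟩
    exact hc i
  exact fun p hp => this hp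

/-- The algebra generated by the pairs `(x y, τ(y) X)` with `(x, X)` in `S` and `y` in `ℬ`. -/
def mixedPairs (τ : A →ₗ[ℂ] ℂ) (S : NonUnitalStarSubalgebra ℂ (A × (H →L[ℂ] H)))
    (ℬ : StarSubalgebra ℂ A) : NonUnitalSubalgebra ℂ (A × (H →L[ℂ] H)) :=
  NonUnitalAlgebra.adjoin ℂ {p | ∃ q ∈ S, ∃ y ∈ ℬ, p = (q.1 * y, τ y • q.2)}

variable {τ : A →ₗ[ℂ] ℂ} {S : NonUnitalStarSubalgebra ℂ (A × (H →L[ℂ] H))} {ℬ : StarSubalgebra ℂ A}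

theorem mk_mem_mixedPairs {q : A × (H →L[ℂ] H)} (hq : q ∈ S) {y : A} (hy : y ∈ ℬ) :
    (q.1 * y, τ y • q.2) ∈ mixedPairs τ S ℬ :=
  NonUnitalAlgebra.subset_adjoin ℂ ⟨q, hq, y, hy, rfl⟩

theorem le_mixedPairs (hτ : τ 1 = 1) {q : A × (H →L[ℂ] H)} (hq : q ∈ S) :
    q ∈ mixedPairs τ S ℬ := by
  simpa [hτ] using mk_mem_mixedPairs (τ := τ) hq (one_mem ℬ)

variable {ω : TracialWeight A} {Ω : A →ₗ[ℂ] ℂ} {𝒜 : NonUnitalStarSubalgebra ℂ A}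

theorem exists_list_of_mem_closure {p : A × (H →L[ℂ] H)}
    (hp : p ∈ Subsemigroup.closure {p | ∃ q ∈ S, ∃ y ∈ ℬ, p = (q.1 * y, τ y • q.2)}) :
    ∃ l : List ((A × (H →L[ℂ] H)) × A), l ≠ [] ∧ (∀ t ∈ l, t.1 ∈ S ∧ t.2 ∈ ℬ) ∧
      p = (l.map fun t => (t.1.1 * t.2, τ t.2 • t.1.2)).prod := by
  induction hp using Subsemigroup.closure_induction with
  | mem p hp =>
    obtain ⟨q, hq, y, hy, rfl⟩ := hp
    exact ⟨[(q, y)], by simp, by simp [hq, hy], by simp⟩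
  | mul p q _ _ hp hq =>
    obtain ⟨l, hl, hl', rfl⟩ := hp
    obtain ⟨m, hm, hm', rfl⟩ := hq
    refine ⟨l ++ m, by simp [hl], fun t ht => ?_, by simp⟩
    exact (List.mem_append.1 ht).elim (hl' t) (hm' t)

theorem list_map_prod_mem {l : List ((A × (H →L[ℂ] H)) × A)} (hl : l ≠ [])
    (h : ∀ t ∈ l, t.1 ∈ S) : (l.map Prod.fst).prod ∈ S := by
  induction l with
  | nil => exact absurd rfl hl
  | cons t l ih =>
    rw [List.map_cons, List.prod_cons]
    rcases eq_or_ne l [] with rfl | hne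
    · simpa using h t
    · exact mul_mem (h t (by simp)) (ih hne fun s hs => h s (by simp [hs]))

theorem list_prod_pair (l : List ((A × (H →L[ℂ] H)) × A)) :
    (l.map fun t => (t.1.1 * t.2, τ t.2 • t.1.2)).prod =
      ((l.map fun t => t.1.1 * t.2).prod,
        (l.map fun t => τ t.2).prod • (l.map Prod.fst).prod.2) := by
  induction l with
  | nil => simp [Prod.one_eq_mk]
  | cons t l ih =>
    simp only [List.map_cons, List.prod_cons, ih, Prod.mk_mul_mk, smul_mul_smul_comm, Prod.snd_mul]

theorem ofFn_get_cast {α β : Type*} (l : List α) {n : ℕ} (hn : l.length = n) (f : α → β) :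
    List.ofFn (fun i : Fin n => f (l.get (i.cast hn.symm))) = l.map f := by
  subst hn
  conv_rhs => rw [← List.ofFn_get l, List.map_ofFn]
  rfl

/-- By linearity it suffices to treat a product of generators, and there the claim about traces is
the defining formula of cyclic monotonicity. The factor `u` on the left plays the role of `y₀` in
the words spanning the ideal. -/
theorem mem_of_mem_mixedPairs (hΩ : ∀ z (hz : z ∈ ω.domain), Ω z = ω.map ⟨z, hz⟩)
    (hcm : IsCyclicallyMonotone ω τ 𝒜 ℬ) (h𝒜 : ∀ z ∈ 𝒜, z ∈ ω.domain)
    (hS : ∀ p ∈ S, p ∈ traceGraph Ω H) (hS𝒜 : ∀ p ∈ S, p.1 ∈ 𝒜) {p : A × (H →L[ℂ] H)}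
    (hp : p ∈ mixedPairs τ S ℬ) :
    (∀ u ∈ ℬ, u * p.1 ∈ mixedIdeal 𝒜 ℬ) ∧ p ∈ traceGraph Ω H := by
  let V : Submodule ℂ (A × (H →L[ℂ] H)) :=
    { carrier := {p | (∀ u ∈ ℬ, u * p.1 ∈ mixedIdeal 𝒜 ℬ) ∧ p ∈ traceGraph Ω H}
      add_mem' := fun hp hq => ⟨fun u hu => by
        simpa [mul_add] using add_mem (hp.1 u hu) (hq.1 u hu), add_mem hp.2 hq.2⟩
      zero_mem' := ⟨fun u hu => by simp, zero_mem _⟩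
      smul_mem' := fun c p hp => ⟨fun u hu => by
        simpa using Submodule.smul_mem _ c (hp.1 u hu), Submodule.smul_mem _ c hp.2⟩ }
  have hp' : p ∈ (mixedPairs τ S ℬ).toSubmodule := hp
  rw [mixedPairs, NonUnitalAlgebra.adjoin_eq_span] at hp'
  refine Submodule.span_le (p := V).2 ?_ hp'
  intro q hq
  obtain ⟨l, hl, hlS, rfl⟩ := exists_list_of_mem_closure hq
  have hlprod := list_map_prod_mem hl fun t ht => (hlS t ht).1
  rw [list_prod_pair]
  -- Words in `mixedIdeal` and `IsCyclicallyMonotone` are indexed by `Fin (n + 1)`, so a nonempty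
  -- list of factors is matched with that form.
  obtain ⟨n, hn⟩ : ∃ n, l.length = n + 1 := ⟨l.length - 1, by
    have := List.length_pos_iff.2 hl
    omega⟩
  have hmem : ∀ i : Fin (n + 1), (l.get (i.cast hn.symm)).1 ∈ S ∧ (l.get (i.cast hn.symm)).2 ∈ ℬ :=
    fun i => hlS _ (List.get_mem _ _)
  have hideal : ∀ u ∈ ℬ, u * (l.map fun t => t.1.1 * t.2).prod ∈ mixedIdeal 𝒜 ℬ := fun u hu =>
    Submodule.subset_span ⟨n, fun i => (l.get (i.cast hn.symm)).1.1, u,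
      fun i => (l.get (i.cast hn.symm)).2, fun i => hS𝒜 _ (hmem i).1, hu, fun i => (hmem i).2, by
        rw [← ofFn_get_cast l hn]⟩
  have hfst : (l.map fun t => t.1.1).prod = (l.map Prod.fst).prod.1 := by
    have := map_list_prod (MonoidHom.fst A (H →L[ℂ] H)) (l.map Prod.fst)
    rw [List.map_map] at this
    exact this.symm
  refine ⟨hideal, (hS _ hlprod).1.smul _, ?_⟩
  have h₁ : (l.map fun t => t.1.1 * t.2).prod ∈ ω.domain := by
    simpa using hcm.1 _ (hideal 1 (one_mem ℬ))
  have h₂ : (l.map fun t => t.1.1).prod ∈ ω.domain := by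
    rw [hfst]
    exact h𝒜 _ (hS𝒜 _ hlprod)
  have key := hcm.2 n (fun i => (l.get (i.cast hn.symm)).1.1)
    (fun i => (l.get (i.cast hn.symm)).2) (fun i => hS𝒜 _ (hmem i).1) (fun i => (hmem i).2)
    (by rw [ofFn_get_cast l hn fun t => t.1.1 * t.2]; exact h₁) (by rw [ofFn_get_cast l hn fun t => t.1.1]; exact h₂)
  rw [← hΩ, ← hΩ, ← List.prod_ofFn, ofFn_get_cast l hn fun t => t.1.1 * t.2, ofFn_get_cast l hn fun t => t.1.1,
    ofFn_get_cast l hn fun t => τ t.2, hfst, (hS _ hlprod).2] at key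
  rw [operatorTrace_smul (hS _ hlprod).1, mul_comm]
  exact key

end Pairs

/-! ### Moments of sums `∑ uᵢ xᵢ vᵢ`, and positivity of `τ`. -/

section Conjugation

variable {A : Type*} [Ring A] [StarRing A] [Algebra ℂ A] [StarModule ℂ A]
  {H : Type*} [NormedAddCommGroup H] [InnerProductSpace ℂ H] [CompleteSpace H]
  {τ : A →ₗ[ℂ] ℂ} {S : NonUnitalStarSubalgebra ℂ (A × (H →L[ℂ] H))} {ℬ : StarSubalgebra ℂ A}
  {ω : TracialWeight A} {Ω : A →ₗ[ℂ] ℂ}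

theorem TracialWeight.extend_mul_comm (hΩ : ∀ z (hz : z ∈ ω.domain), Ω z = ω.map ⟨z, hz⟩) {x y : A}
    (hx : x ∈ ω.domain) (hy : y ∈ ω.domain) : Ω (x * y) = Ω (y * x) := by
  rw [hΩ _ (mul_mem hx hy), hΩ _ (mul_mem hy hx)]
  exact ω.tracial ⟨x, hx⟩ ⟨y, hy⟩

theorem TracialWeight.extend_star (hΩ : ∀ z (hz : z ∈ ω.domain), Ω z = ω.map ⟨z, hz⟩) {x : A}
    (hx : x ∈ ω.domain) : Ω (star x) = star (Ω x) := by
  rw [hΩ _ (star_mem hx), hΩ _ hx]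
  exact ω.selfadjoint ⟨x, hx⟩

theorem TracialWeight.extend_nonneg (hΩ : ∀ z (hz : z ∈ ω.domain), Ω z = ω.map ⟨z, hz⟩) {x : A}
    (hx : x ∈ ω.domain) : 0 ≤ Ω (star x * x) := by
  rw [hΩ _ (mul_mem (star_mem hx) hx)]
  exact ω.positive ⟨x, hx⟩

theorem matrix_pow_succ_mem {R : Type*} [Ring R] [Algebra ℂ R] {T : NonUnitalSubalgebra ℂ R} {k : ℕ}
    {M : Matrix (Fin k) (Fin k) R} (hM : ∀ i j, M i j ∈ T) (n : ℕ) (i j : Fin k) :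
    (M ^ (n + 1)) i j ∈ T := by
  induction n generalizing i j with
  | zero => simpa using hM i j
  | succ n ih =>
    rw [pow_succ, Matrix.mul_apply]
    exact sum_mem fun l _ => mul_mem (ih i l) (hM l j)

/-- Regrouping: in `(u x v)(u x v)⋯(u x v)` each inner `v` is joined to the `u` that follows it,
which leaves one `u` at the left end and one `x v` at the right end. -/
theorem pow_succ_sum_conj {R : Type*} [Ring R] {k : ℕ} (u x v : Fin k → R) (n : ℕ) :
    (∑ i, u i * x i * v i) ^ (n + 1) =
      ∑ i, ∑ j, u i * ((Matrix.of fun i j => x i * (v i * u j)) ^ n) i j * (x j * v j) := by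
  induction n with
  | zero => simp [Matrix.one_apply, mul_assoc]
  | succ n ih =>
    rw [pow_succ _ (n + 1), ih, Finset.sum_mul]
    refine Finset.sum_congr rfl fun i _ => ?_
    simp only [pow_succ _ n, Matrix.mul_apply, Finset.mul_sum, Finset.sum_mul, Matrix.of_apply]
    simp only [mul_assoc]

/-- The moments of `∑ uᵢ xᵢ vᵢ` are those of the matrix `(τ(vᵢ uⱼ) Xᵢ)`. -/
theorem extend_pow_sum_conj (hΩ : ∀ z (hz : z ∈ ω.domain), Ω z = ω.map ⟨z, hz⟩)
    (hT : ∀ p ∈ mixedPairs τ S ℬ, (∀ u ∈ ℬ, u * p.1 ∈ ω.domain) ∧ p ∈ traceGraph Ω H)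
    {k : ℕ} {u v : Fin k → A} {q : Fin k → A × (H →L[ℂ] H)} (hq : ∀ i, q i ∈ S)
    (hu : ∀ i, u i ∈ ℬ) (hv : ∀ i, v i ∈ ℬ)
    (h : ∀ i, Ω (u i * ((q i).1 * v i)) = Ω ((q i).1 * (v i * u i))) (n : ℕ) :
    Ω ((∑ i, u i * (q i).1 * v i) ^ (n + 1)) =
      ∑ i, operatorTrace (((Matrix.of fun i j => τ (v i * u j) • (q i).2) ^ (n + 1)) i i) := by
  let M : Matrix (Fin k) (Fin k) (A × (H →L[ℂ] H)) :=
    Matrix.of fun i j => ((q i).1 * (v i * u j), τ (v i * u j) • (q i).2)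
  have hM : ∀ i j, M i j ∈ mixedPairs τ S ℬ := fun i j =>
    mk_mem_mixedPairs (hq i) (mul_mem (hv i) (hu j))
  have hfst : ∀ n i j, ((M ^ n) i j).1 =
      ((Matrix.of fun i j => (q i).1 * (v i * u j)) ^ n) i j := fun n i j =>
    congrFun (congrFun (map_pow (RingHom.fst A (H →L[ℂ] H)).mapMatrix M n) i) j
  have hsnd : ∀ n i j, ((M ^ n) i j).2 =
      ((Matrix.of fun i j => τ (v i * u j) • (q i).2) ^ n) i j := fun n i j =>
    congrFun (congrFun (map_pow (RingHom.snd A (H →L[ℂ] H)).mapMatrix M n) i) j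
  have hdom : ∀ p ∈ mixedPairs τ S ℬ, p.1 ∈ ω.domain := fun p hp => by
    simpa using (hT p hp).1 1 (one_mem ℬ)
  have h₁ : ∀ i, Ω ((M ^ (n + 1)) i i).1 = operatorTrace ((M ^ (n + 1)) i i).2 := fun i =>
    (hT _ (matrix_pow_succ_mem hM n i i)).2.2
  simp only [← hsnd, ← h₁]
  rw [pow_succ_sum_conj u (fun i => (q i).1) v, map_sum]
  simp only [← hfst, map_sum]
  -- The outer `uᵢ` has to move to the right end, but it need not lie in `D(ω)`. For powers of
  -- exponent at least two the word splits into two factors in `D(ω)`, and traciality of `ω` applies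
  -- twice. A first power offers no such splitting; this is the only place where `h` enters.
  have h₂ : ∀ i j, Ω (u i * ((M ^ n) i j).1 * ((q j).1 * v j)) =
      Ω (((M ^ n) i j).1 * ((q j).1 * (v j * u i))) := by
    intro i j
    cases n with
    | zero =>
      rcases eq_or_ne i j with rfl | hij
      · simpa using h i
      · simp [Matrix.one_apply_ne hij]
    | succ n =>
      have hz := hT _ (matrix_pow_succ_mem hM n i j)
      rw [TracialWeight.extend_mul_comm hΩ (hz.1 _ (hu i))
          (hdom _ (mk_mem_mixedPairs (hq j) (hv j))), ← mul_assoc,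
        TracialWeight.extend_mul_comm hΩ _ (hdom _ (matrix_pow_succ_mem hM n i j)), mul_assoc]
      rw [mul_assoc]
      exact hdom _ (mk_mem_mixedPairs (hq j) (mul_mem (hv j) (hu i)))
  refine Finset.sum_congr rfl fun i _ => ?_
  simp only [h₂, ← map_sum]
  rw [pow_succ, Matrix.mul_apply, Prod.fst_sum]
  rfl

/-- If `S` contains a pair with a nonzero second entry, then `τ` is a positive functional on `ℬ`. -/
theorem star_and_nonneg_of_ne_zero (hτ : τ 1 = 1)
    (hΩ : ∀ z (hz : z ∈ ω.domain), Ω z = ω.map ⟨z, hz⟩)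
    (hT : ∀ p ∈ mixedPairs τ S ℬ, (∀ u ∈ ℬ, u * p.1 ∈ ω.domain) ∧ p ∈ traceGraph Ω H)
    (hS : ∀ p ∈ S, p ∈ traceGraph Ω H)
    {q : A × (H →L[ℂ] H)} (hq : q ∈ S) (h0 : q.2 ≠ 0) {y : A} (hy : y ∈ ℬ) :
    τ (star y) = star (τ y) ∧ 0 ≤ τ (star y * y) := by
  obtain ⟨ht, ht'⟩ := operatorTrace_star_mul_self (hS q hq).1
  have ht0 : operatorTrace (star q.2 * q.2) ≠ 0 := fun h => h0 (ht' h)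
  -- A `z` placed between `x*` and `x` contributes exactly the factor `τ(z)`, so properties of `ω`
  -- pass to `τ` after division by `Tr(X* X) > 0`.
  have hmem : ∀ z ∈ ℬ, (star q.1 * z * q.1, τ z • (star q.2 * q.2)) ∈ mixedPairs τ S ℬ := by
    intro z hz
    have := mul_mem (mk_mem_mixedPairs (τ := τ) (star_mem hq) hz) (le_mixedPairs hτ hq)
    convert this using 1
    exact Prod.ext rfl (smul_mul_assoc _ _ _).symm
  have key : ∀ z ∈ ℬ, Ω (star q.1 * z * q.1) = τ z * operatorTrace (star q.2 * q.2) := by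
    intro z hz
    rw [← operatorTrace_smul (x := star q.2 * q.2) (hS _ (mul_mem (star_mem hq) hq)).1]
    exact (hT _ (hmem z hz)).2.2
  have hdom : star q.1 * y * q.1 ∈ ω.domain := by
    simpa using (hT _ (hmem y hy)).1 1 (one_mem ℬ)
  constructor
  · have h1 := TracialWeight.extend_star hΩ hdom
    rw [star_mul, star_mul, star_star, ← mul_assoc, key _ (star_mem hy), key _ hy, star_mul',
      (IsSelfAdjoint.of_nonneg ht).star_eq] at h1
    exact mul_right_cancel₀ ht0 h1
  · have h1 := TracialWeight.extend_nonneg hΩ ((hT _ (le_mixedPairs hτ hq)).1 y hy)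
    rw [star_mul, mul_assoc, ← mul_assoc (star y), ← mul_assoc, key _ (mul_mem (star_mem hy) hy)]
      at h1
    exact le_of_mul_le_mul_right (by simpa using h1) (lt_of_le_of_ne ht ht0.symm)

/-- A pair in `S` with selfadjoint first entry has a selfadjoint second entry. -/
theorem isSelfAdjoint_snd (hS : ∀ p ∈ S, p ∈ traceGraph Ω H) {q : A × (H →L[ℂ] H)} (hq : q ∈ S)
    (h : IsSelfAdjoint q.1) : IsSelfAdjoint q.2 := by
  have h1 : q - star q ∈ S := sub_mem hq (star_mem hq)
  have h2 := (hS _ (mul_mem (star_mem h1) h1)).2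
  -- A pair in `S` with first entry `0` has `Tr(Z* Z) = Ω(0) = 0`, hence second entry `0`.
  have h3 : (q - star q).1 = 0 := by simp [h.star_eq]
  have h4 := (operatorTrace_star_mul_self (hS _ h1).1).2 (by
    rw [Prod.fst_mul, h3, mul_zero, map_zero] at h2
    exact h2.symm)
  exact (sub_eq_zero.1 h4).symm

end Conjugation

/-! ### The matrix `√B diag(a₁, …, a_k) √B` -/

section Sandwich

variable {k : ℕ} (B : Matrix (Fin k) (Fin k) ℂ) {R : Type*} [Ring R] [Algebra ℂ R]

theorem mul_pow_succ_eq {M : Type*} [Monoid M] (a b : M) (n : ℕ) :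
    (a * b) ^ (n + 1) = a * ((b * a) ^ n * b) := by
  rw [← mul_assoc, ← mul_pow_mul, pow_succ, mul_assoc]

theorem sandwich_apply (a : Fin k → R) (i j : Fin k) :
    sandwich B a i j = ∑ l, (CFC.sqrt B i l * CFC.sqrt B l j) • a l := by
  rw [sandwich, Matrix.mul_apply]
  refine Finset.sum_congr rfl fun l _ => ?_
  rw [Matrix.mul_diagonal, Matrix.map_apply, Matrix.map_apply, mul_assoc, ← Algebra.commutes, ← mul_assoc, ← map_mul, Algebra.smul_def]

theorem map_sandwich {R' : Type*} [Ring R'] [Algebra ℂ R'] (f : R →ₐ[ℂ] R') (a : Fin k → R) :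
    (sandwich B a).map f = sandwich B fun i => f (a i) := by
  ext i j
  simp [sandwich_apply]

theorem sandwich_pow_apply_map {R' : Type*} [Ring R'] [Algebra ℂ R'] (f : R →ₐ[ℂ] R')
    (a : Fin k → R) (n : ℕ) (i j : Fin k) :
    f ((sandwich B a ^ n) i j) = (sandwich B (fun i => f (a i)) ^ n) i j := by
  rw [← map_sandwich]
  exact congrFun (congrFun (map_pow f.mapMatrix (sandwich B a) n) i) j

theorem star_sandwich_apply [StarRing R] [StarModule ℂ R] {a : Fin k → R}
    (ha : ∀ i, IsSelfAdjoint (a i)) (i j : Fin k) : star (sandwich B a j i) = sandwich B a i j := by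
  -- `CFC.sqrt B` is nonnegative for every `B`, hence hermitian even if `B` is not positive.
  have h : ∀ i j, star (CFC.sqrt B j i) = CFC.sqrt B i j := fun i j =>
    congrFun (congrFun (IsSelfAdjoint.of_nonneg (CFC.sqrt_nonneg B)).star_eq i) j
  simp only [sandwich_apply, star_sum, star_smul, (ha _).star_eq, star_mul', h]
  exact Finset.sum_congr rfl fun l _ => by rw [mul_comm]

variable {B} {H : Type*} [NormedAddCommGroup H] [InnerProductSpace ℂ H] [CompleteSpace H]

/-- With `P = √B` and `Q = diag(x) √B` the two matrices are `P Q` and `Q P`. Cyclicity moves only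
the scalar matrix `P`, so linearity of the trace suffices. Positivity of `B` is what gives `√B √B =
B`. -/
theorem sum_operatorTrace_sandwich_pow {x : Fin k → H →L[ℂ] H}
    (hx : ∀ i, IsTraceClassOperator (x i)) (h : (∀ i, x i = 0) ∨ 0 ≤ B) (n : ℕ) :
    ∑ i, operatorTrace ((sandwich B x ^ (n + 1)) i i) =
      ∑ i, operatorTrace (((Matrix.of fun i j => B i j • x i) ^ (n + 1)) i i) := by
  rcases h with h | h
  · have h1 : sandwich B x = 0 := by ext1; simp [sandwich_apply, h]
    have h2 : (Matrix.of fun i j => B i j • x i) = 0 := by ext1; simp [h]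
    rw [h1, h2]
  · let P : Matrix (Fin k) (Fin k) (H →L[ℂ] H) := (CFC.sqrt B).map (algebraMap ℂ (H →L[ℂ] H))
    let Q := Matrix.diagonal x * P
    have hN : (Matrix.of fun i j => B i j • x i) = Q * P := by
      rw [mul_assoc, ← Matrix.map_mul, CFC.sqrt_mul_sqrt_self B h]
      ext1 i j
      rw [Matrix.diagonal_mul, Matrix.map_apply, Matrix.of_apply, ← Algebra.commutes,
        Algebra.smul_def]
    have hW : sandwich B x = P * Q := by simp only [sandwich, P, Q, mul_assoc]
    have hZ : ∀ i j, IsTraceClassOperator (((Q * P) ^ n * Q) i j) := by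
      intro i j
      rw [Matrix.mul_apply]
      refine isTraceClassOperator_sum _ fun l _ => IsTraceClassOperator.mul_left ?_ _
      simp only [Q, P, Matrix.diagonal_mul, Matrix.map_apply, ← Algebra.commutes]
      exact (hx l).mul_left _
    have hP : ∀ i j, P i j = algebraMap ℂ (H →L[ℂ] H) (CFC.sqrt B i j) := fun _ _ => rfl
    have hQP : (Q * P) ^ (n + 1) = (Q * P) ^ n * Q * P :=
      (pow_succ _ _).trans (mul_assoc _ _ _).symm
    rw [hN, hW, mul_pow_succ_eq, hQP]
    generalize (Q * P) ^ n * Q = Z at hZ ⊢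
    have h1 : ∀ i, (P * Z) i i = ∑ j, CFC.sqrt B i j • Z j i := fun i => by
      rw [Matrix.mul_apply]
      exact Finset.sum_congr rfl fun j _ => by rw [hP, Algebra.smul_def]
    have h2 : ∀ i, (Z * P) i i = ∑ j, CFC.sqrt B j i • Z i j := fun i => by
      rw [Matrix.mul_apply]
      exact Finset.sum_congr rfl fun j _ => by rw [hP, ← Algebra.commutes, Algebra.smul_def]
    have h3 : ∀ i j, IsTraceClassOperator (CFC.sqrt B i j • Z j i) := fun i j => (hZ j i).smul _
    have h4 : ∀ i j, IsTraceClassOperator (CFC.sqrt B j i • Z i j) := fun i j => (hZ i j).smul _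
    simp only [h1, h2, fun i => operatorTrace_sum Finset.univ fun l _ => h3 i l,
      fun i => operatorTrace_sum Finset.univ fun l _ => h4 i l]
    rw [Finset.sum_comm]

end Sandwich

/-! ### Two by two matrices -/

/-- By Cayley–Hamilton both sides satisfy the same two-term recursion. -/
theorem trace_pow_fin_two {C : Matrix (Fin 2) (Fin 2) ℂ} {p q : ℂ} (h₁ : p + q = C 0 0 + C 1 1)
    (h₂ : p * q = C 0 0 * C 1 1 - C 0 1 * C 1 0) (n : ℕ) : (C ^ n).trace = p ^ n + q ^ n := by
  have hC : C * C = (p + q) • C - (p * q) • 1 := by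
    rw [h₁, h₂]
    ext i j
    fin_cases i <;> fin_cases j <;> simp [Matrix.mul_apply, Fin.sum_univ_two] <;> ring
  induction n using Nat.twoStepInduction with
  | zero => simp; norm_num
  | one => simp [Matrix.trace, h₁]
  | more n ih₁ ih₂ =>
    rw [pow_add, pow_two C, hC, mul_sub, mul_smul_comm, mul_smul_comm, mul_one, ← pow_succ,
      Matrix.trace_sub, Matrix.trace_smul, Matrix.trace_smul, ih₁, ih₂]
    simp only [smul_eq_mul]
    ring

section TwoByTwo

variable {A : Type*} [Ring A] [StarRing A] [Algebra ℂ A] [StarModule ℂ A]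
  {ω : TracialWeight A} {Ω : A →ₗ[ℂ] ℂ}
  {H : Type} [NormedAddCommGroup H] [InnerProductSpace ℂ H] [CompleteSpace H]
  [TopologicalSpace.SeparableSpace H]

/-- The operator `pX ⊕ qX` on `H ⊕ H` is a model of `y`. -/
theorem isTraceClass_and_EV_eq_add (hΩ : ∀ z (hz : z ∈ ω.domain), Ω z = ω.map ⟨z, hz⟩)
    {y : A} (hy : y ∈ ω.domain) (hysa : IsSelfAdjoint y) {X : H →L[ℂ] H}
    (hX : IsTraceClassOperator X) (hXsa : IsSelfAdjoint X) {p q : ℂ}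
    (hpq : X = 0 ∨ IsSelfAdjoint p ∧ IsSelfAdjoint q)
    (h : ∀ n, Ω (y ^ (n + 1)) = (p ^ (n + 1) + q ^ (n + 1)) * operatorTrace (X ^ (n + 1))) :
    IsTraceClass ω y ∧
      EV ω y = scaleEV p (operatorEV X) + scaleEV q (operatorEV X) := by
  have hsa : ∀ i, IsSelfAdjoint ((![p • X, q • X] : Fin 2 → H →L[ℂ] H) i) := by
    rcases hpq with rfl | ⟨hp, hq⟩
    · intro i; fin_cases i <;> simp
    · intro i; fin_cases i
      exacts [hp.smul hXsa, hq.smul hXsa]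
  have htc : ∀ i, IsTraceClassOperator ((![p • X, q • X] : Fin 2 → H →L[ℂ] H) i) := by
    intro i; fin_cases i
    exacts [hX.smul p, hX.smul q]
  let M : Matrix (Fin 2) (Fin 2) (H →L[ℂ] H) := Matrix.diagonal ![p • X, q • X]
  have hM : ∀ i j, IsTraceClassOperator (M i j) := by
    intro i j
    rcases eq_or_ne i j with rfl | hij
    · simpa [M] using htc i
    · simpa [M, hij] using hasTrace_zero.isTraceClassOperator
  have hMsa : IsSelfAdjoint (blockOperator M) := isSelfAdjoint_blockOperator fun i j => by
    rcases eq_or_ne i j with rfl | hij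
    · simpa [M] using (hsa i).star_eq
    · simp [M, hij, hij.symm]
  have hXn : ∀ n, IsTraceClassOperator (X ^ (n + 1)) := fun n => pow_succ X n ▸ hX.mul_left _
  have htr : ∀ (c : ℂ) n, operatorTrace ((c • X) ^ (n + 1)) =
      c ^ (n + 1) * operatorTrace (X ^ (n + 1)) := fun c n => by
    rw [smul_pow, operatorTrace_smul (hXn n)]
  have hMtr : ∀ n, operatorTrace (blockOperator M ^ (n + 1)) =
      operatorTrace ((p • X) ^ (n + 1)) + operatorTrace ((q • X) ^ (n + 1)) := by
    intro n
    rw [← blockOperator_pow_succ]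
    have hMn : ∀ i j, IsTraceClassOperator ((M ^ (n + 1)) i j) := by
      intro i j
      rw [pow_succ, Matrix.mul_apply]
      exact isTraceClassOperator_sum _ fun l _ => (hM l j).mul_left _
    rw [(hasTrace_blockOperator hMn).operatorTrace_eq, Fin.sum_univ_two, Matrix.diagonal_pow]
    simp
  have hYtc := (hasTrace_blockOperator hM).isTraceClassOperator
  have key := isTraceClass_and_EV_eq_of_isSelfAdjoint hΩ hy hysa hYtc hMsa fun n => by
    rw [h, hMtr, htr, htr, add_mul]
  refine ⟨key.1, key.2.trans ?_⟩
  rw [operatorEV_eq_add hYtc hMsa (hX.smul p) (hsa 0) (hX.smul q) (hsa 1) hMtr, operatorEV_smul,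
    operatorEV_smul]

end TwoByTwo

/-! ### The four families of polynomials -/

section Eigenvalues

variable {A : Type*} [Ring A] [StarRing A] [Algebra ℂ A] [StarModule ℂ A]
  {H : Type} [NormedAddCommGroup H] [InnerProductSpace ℂ H] [CompleteSpace H]
  [TopologicalSpace.SeparableSpace H]
  {τ : A →ₗ[ℂ] ℂ} {S : NonUnitalStarSubalgebra ℂ (A × (H →L[ℂ] H))} {ℬ : StarSubalgebra ℂ A}
  {ω : TracialWeight A} {Ω : A →ₗ[ℂ] ℂ}

theorem matrix_extend (hΩ : ∀ z (hz : z ∈ ω.domain), Ω z = ω.map ⟨z, hz⟩) (k : ℕ)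
    (M : Matrix (Fin k) (Fin k) A) (hM : M ∈ (ω.matrix k).domain) :
    (Ω ∘ₗ Matrix.traceLinearMap (Fin k) ℂ A) M = (ω.matrix k).map ⟨M, hM⟩ := by
  rw [LinearMap.comp_apply, Matrix.traceLinearMap_apply, Matrix.trace, map_sum]
  exact Finset.sum_congr rfl fun i _ => hΩ _ _

/-- The case of `∑ bᵢ aᵢ bᵢ*`. -/
theorem isTraceClass_and_EV_sum_conj (hτ : τ 1 = 1)
    (hΩ : ∀ z (hz : z ∈ ω.domain), Ω z = ω.map ⟨z, hz⟩)
    (hT : ∀ p ∈ mixedPairs τ S ℬ, (∀ u ∈ ℬ, u * p.1 ∈ ω.domain) ∧ p ∈ traceGraph Ω H)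
    (hS : ∀ p ∈ S, p ∈ traceGraph Ω H) {k : ℕ} {a b : Fin k → A} {X : Fin k → H →L[ℂ] H}
    (hq : ∀ i, (a i, X i) ∈ S) (hb : ∀ i, b i ∈ ℬ) (ha : ∀ i, IsSelfAdjoint (a i))
    (h : ∀ i, Ω (b i * (a i * star (b i))) = Ω (a i * (star (b i) * b i)))
    {B : Matrix (Fin k) (Fin k) ℂ} (hB : B = Matrix.of fun i j => τ (star (b i) * b j))
    (hpos : (∀ i, X i = 0) ∨ 0 ≤ B) :
    IsTraceClass ω (∑ i, b i * a i * star (b i)) ∧ IsTraceClass (ω.matrix k) (sandwich B a) ∧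
      EV ω (∑ i, b i * a i * star (b i)) = EV (ω.matrix k) (sandwich B a) := by
  have hSd : ∀ p ∈ S, p.1 ∈ ω.domain := fun p hp => by
    simpa using (hT p (le_mixedPairs hτ hp)).1 1 (one_mem ℬ)
  have hX : ∀ i, IsSelfAdjoint (X i) := fun i => isSelfAdjoint_snd (q := (a i, X i)) hS (hq i) (ha i)
  have hXtc : ∀ i, IsTraceClassOperator (X i) := fun i => (hS _ (hq i)).1
  -- `W` carries the sandwich matrices of `a` and of `X` at once. The block operator of the latter
  -- serves as a common model for both elements whose eigenvalues are compared.
  let W : Matrix (Fin k) (Fin k) (A × (H →L[ℂ] H)) := sandwich B fun i => (a i, X i)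
  have hWS : ∀ i j, W i j ∈ S := fun i j => by
    simp only [W, sandwich_apply]
    exact sum_mem fun l _ => SMulMemClass.smul_mem _ (hq l)
  have hfst : ∀ n i j, ((W ^ n) i j).1 = (sandwich B a ^ n) i j :=
    sandwich_pow_apply_map B (AlgHom.fst ℂ A (H →L[ℂ] H)) fun i => (a i, X i)
  have hsnd : ∀ n i j, ((W ^ n) i j).2 = (sandwich B X ^ n) i j :=
    sandwich_pow_apply_map B (AlgHom.snd ℂ A (H →L[ℂ] H)) fun i => (a i, X i)
  have hWn : ∀ n i j, (W ^ (n + 1)) i j ∈ S := fun n i j =>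
    matrix_pow_succ_mem (T := S.toNonUnitalSubalgebra) hWS n i j
  have htc : ∀ n i j, IsTraceClassOperator ((sandwich B X ^ (n + 1)) i j) := fun n i j => by
    rw [← hsnd]
    exact (hS _ (hWn n i j)).1
  have htc1 : ∀ i j, IsTraceClassOperator (sandwich B X i j) := by simpa using htc 0
  have hYtc := (hasTrace_blockOperator htc1).isTraceClassOperator
  have hYsa : IsSelfAdjoint (blockOperator (sandwich B X)) :=
    isSelfAdjoint_blockOperator (star_sandwich_apply B hX)
  have hYtr : ∀ n, operatorTrace (blockOperator (sandwich B X) ^ (n + 1)) =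
      ∑ i, operatorTrace ((sandwich B X ^ (n + 1)) i i) := fun n => by
    rw [← blockOperator_pow_succ, (hasTrace_blockOperator (htc n)).operatorTrace_eq]
  have hydom : ∑ i, b i * a i * star (b i) ∈ ω.domain := by
    refine sum_mem fun i _ => ?_
    rw [mul_assoc]
    exact (hT _ (mk_mem_mixedPairs (hq i) (star_mem (hb i)))).1 _ (hb i)
  have hysa : IsSelfAdjoint (∑ i, b i * a i * star (b i)) :=
    isSelfAdjoint_sum _ fun i _ => (ha i).conjugate (b i)
  have h₁ := isTraceClass_and_EV_eq_of_isSelfAdjoint hΩ hydom hysa hYtc hYsa fun n => by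
    rw [extend_pow_sum_conj (u := b) (v := fun i => star (b i)) (q := fun i => (a i, X i)) hΩ hT
      hq hb (fun i => star_mem (hb i)) h, hYtr, sum_operatorTrace_sandwich_pow hXtc hpos, hB]
    rfl
  have hsdom : sandwich B a ∈ (ω.matrix k).domain := fun i j => by
    have := hfst 1 i j
    rw [pow_one, pow_one] at this
    rw [← this]
    exact hSd _ (hWS i j)
  have hssa : IsSelfAdjoint (sandwich B a) := by
    ext1 i j
    exact star_sandwich_apply B ha i j
  have h₂ := isTraceClass_and_EV_eq_of_isSelfAdjoint (matrix_extend hΩ k) hsdom hssa hYtc hYsa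
    fun n => by
      rw [hYtr, LinearMap.comp_apply, Matrix.traceLinearMap_apply, Matrix.trace, map_sum]
      refine Finset.sum_congr rfl fun i _ => ?_
      rw [Matrix.diag_apply, ← hfst, ← hsnd]
      exact (hS _ (hWn n i i)).2
  exact ⟨h₁.1, h₂.1, h₁.2.trans h₂.2.symm⟩

/-- The case of `∑ aᵢ bᵢ aᵢ*`. -/
theorem isTraceClass_and_EV_sum_mul_mul_star (hτ : τ 1 = 1)
    (hΩ : ∀ z (hz : z ∈ ω.domain), Ω z = ω.map ⟨z, hz⟩)
    (hT : ∀ p ∈ mixedPairs τ S ℬ, (∀ u ∈ ℬ, u * p.1 ∈ ω.domain) ∧ p ∈ traceGraph Ω H)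
    (hS : ∀ p ∈ S, p ∈ traceGraph Ω H) {k : ℕ} {a b : Fin k → A} {X : Fin k → H →L[ℂ] H}
    (hq : ∀ i, (a i, X i) ∈ S) (hb : ∀ i, b i ∈ ℬ) (hbsa : ∀ i, IsSelfAdjoint (b i))
    (hreal : (∀ i, X i = 0) ∨ ∀ i, IsSelfAdjoint (τ (b i))) :
    IsTraceClass ω (∑ i, a i * b i * star (a i)) ∧
      IsTraceClass ω (∑ i, τ (b i) • (a i * star (a i))) ∧
      EV ω (∑ i, a i * b i * star (a i)) = EV ω (∑ i, τ (b i) • (a i * star (a i))) := by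
  let Y : H →L[ℂ] H := ∑ i, τ (b i) • (X i * star (X i))
  have hYsa : IsSelfAdjoint Y := by
    rcases hreal with h | h
    · simp [Y, h]
    · exact isSelfAdjoint_sum _ fun i _ => (h i).smul (.mul_star_self _)
  -- Each summand is the product of the generators built from `(aᵢ, bᵢ)` and `(aᵢ*, 1)`. The two
  -- elements to be compared share the second entry `Y`.
  have hy : (∑ i, a i * b i * star (a i), Y) ∈ mixedPairs τ S ℬ := by
    have : ∑ i, ((a i, X i).1 * b i, τ (b i) • (a i, X i).2) * star (a i, X i) ∈
        mixedPairs τ S ℬ :=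
      sum_mem fun i _ => mul_mem (mk_mem_mixedPairs (hq i) (hb i))
        (le_mixedPairs hτ (star_mem (hq i)))
    convert this using 1
    ext1
    · rw [Prod.fst_sum]; rfl
    · rw [Prod.snd_sum]
      change ∑ i, τ (b i) • (X i * star (X i)) = _
      exact Finset.sum_congr rfl fun i _ => (smul_mul_assoc _ _ _).symm
  have hz : (∑ i, τ (b i) • (a i * star (a i)), Y) ∈ S := by
    have : ∑ i, τ (b i) • ((a i, X i) * star (a i, X i)) ∈ S :=
      sum_mem fun i _ => SMulMemClass.smul_mem _ (mul_mem (hq i) (star_mem (hq i)))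
    convert this using 1
    ext1
    · rw [Prod.fst_sum]; rfl
    · rw [Prod.snd_sum]; rfl
  have hdom : ∀ p ∈ mixedPairs τ S ℬ, p.1 ∈ ω.domain := fun p hp => by
    simpa using (hT p hp).1 1 (one_mem ℬ)
  have hpow : ∀ n, (∑ i, a i * b i * star (a i), Y) ^ (n + 1) ∈ mixedPairs τ S ℬ := by
    intro n
    induction n with
    | zero => simpa using hy
    | succ n ih => rw [pow_succ]; exact mul_mem ih hy
  have hysa : IsSelfAdjoint (∑ i, a i * b i * star (a i)) :=
    isSelfAdjoint_sum _ fun i _ => (hbsa i).conjugate (a i)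
  have h₁ := isTraceClass_and_EV_eq_of_isSelfAdjoint hΩ (hdom _ hy) hysa (hS _ hz).1 hYsa fun n => (hT _ (hpow n)).2.2
  -- All `*`-words are compared here, not only powers: when every `Xᵢ` is `0` the numbers `τ(bᵢ)`
  -- need not be real, so this element need not be selfadjoint.
  have h₂ := isTraceClass_and_EV_eq hΩ (hdom _ (le_mixedPairs hτ hz)) (hS _ hz).1 hYsa
    fun w => by
      have := hS _ (starWord_mem S (fun _ : Unit => hz) w)
      rw [starWord_prod] at this
      exact this.2
  exact ⟨h₁.1, h₂.1, h₁.2.trans h₂.2.symm⟩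

/-- The case of `a (c b) + b (d a)`, for scalars `c` and `d`. -/
theorem isTraceClass_and_EV_add (hτ : τ 1 = 1)
    (hΩ : ∀ z (hz : z ∈ ω.domain), Ω z = ω.map ⟨z, hz⟩)
    (hT : ∀ p ∈ mixedPairs τ S ℬ, (∀ u ∈ ℬ, u * p.1 ∈ ω.domain) ∧ p ∈ traceGraph Ω H)
    (hS : ∀ p ∈ S, p ∈ traceGraph Ω H) {a b : A} {X : H →L[ℂ] H} (hq : (a, X) ∈ S) (hb : b ∈ ℬ)
    (ha : IsSelfAdjoint a) (hbsa : IsSelfAdjoint b) (hreal : X = 0 ∨ IsSelfAdjoint (τ b))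
    {c d p q : ℂ} (hcd : star c = d) (h₁ : p + q = (c + d) * τ b)
    (h₂ : p * q = c * d * (τ b ^ 2 - τ (b ^ 2)))
    (hpq : X = 0 ∨ IsSelfAdjoint p ∧ IsSelfAdjoint q) :
    IsTraceClass ω (c • (a * b) + d • (b * a)) ∧
      EV ω (c • (a * b) + d • (b * a)) = scaleEV p (EV ω a) + scaleEV q (EV ω a) := by
  have hX := isSelfAdjoint_snd (q := (a, X)) hS hq ha
  have hXtc : IsTraceClassOperator X := (hS _ hq).1
  have hab := hT _ (mk_mem_mixedPairs (τ := τ) hq hb)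
  have habdom : a * b ∈ ω.domain := by simpa using hab.1 1 (one_mem ℬ)
  have hadom : a ∈ ω.domain := by simpa using (hT _ (le_mixedPairs hτ hq)).1 1 (one_mem ℬ)
  have hbadom : b * a ∈ ω.domain := (hT _ (le_mixedPairs hτ hq)).1 b hb
  have hΩab : Ω (a * b) = τ b * Ω a := by
    rw [(hS _ hq).2, ← operatorTrace_smul hXtc]
    exact hab.2.2
  have hΩa : star (Ω a) = Ω a := by rw [← TracialWeight.extend_star hΩ hadom, ha.star_eq]
  -- For the first moment, `*`-symmetry replaces traciality over `ℬ`: `Ω(ba)` is the conjugate of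
  -- `Ω(ab) = τ(b) Ω(a)`, which is real.
  have hcomm : Ω (b * a) = Ω (a * b) := by
    have : b * a = star (a * b) := by rw [star_mul, ha.star_eq, hbsa.star_eq]
    rw [this, TracialWeight.extend_star hΩ habdom, hΩab, star_mul', hΩa]
    rcases hreal with h | h
    · have : Ω a = 0 := by rw [(hS _ hq).2, h, operatorTrace_zero]
      rw [this, mul_zero, mul_zero]
    · rw [h.star_eq]
  have hEVa : EV ω a = operatorEV X :=
    (isTraceClass_and_EV_eq hΩ hadom hXtc hX fun w => by
      have := hS _ (starWord_mem S (fun _ : Unit => hq) w)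
      rw [starWord_prod] at this
      exact this.2).2
  -- Written as `∑ uᵢ a vᵢ` with `u = (1, b)` and `v = (c b, d)`. The scalar matrix `τ(vᵢ uⱼ)` then
  -- has trace `(c + d) τ(b)` and determinant `c d (τ(b)² - τ(b²))`, whence `h₁` and `h₂`.
  have hy : c • (a * b) + d • (b * a) = ∑ i, (![1, b] : Fin 2 → A) i * a *
      (![c • b, d • 1] : Fin 2 → A) i := by
    simp [Fin.sum_univ_two, mul_assoc]
  rw [hEVa]
  refine isTraceClass_and_EV_eq_add hΩ
    (add_mem (SMulMemClass.smul_mem c habdom) (SMulMemClass.smul_mem d hbadom)) ?_ hXtc hX hpq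
    fun n => ?_
  · rw [IsSelfAdjoint, star_add, star_smul, star_smul, star_mul, star_mul, ha.star_eq,
      hbsa.star_eq, ← hcd, star_star, add_comm]
  · rw [hy, extend_pow_sum_conj (q := fun _ => (a, X)) hΩ hT (fun _ => hq)]
    · let C : Matrix (Fin 2) (Fin 2) ℂ := Matrix.of fun i j =>
        τ ((![c • b, d • 1] : Fin 2 → A) i * (![1, b] : Fin 2 → A) j)
      have hC : ∀ n, (Matrix.of fun i j => C i j • X) ^ n =
          Matrix.of fun i j => (C ^ n) i j • X ^ n := by
        intro n
        induction n with
        | zero => ext1 i j; rcases eq_or_ne i j with rfl | h <;> simp [*]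
        | succ n ih =>
          ext1 i j
          rw [pow_succ, ih, Matrix.mul_apply]
          simp only [Matrix.of_apply, smul_mul_smul_comm, ← pow_succ, ← Finset.sum_smul]
          rw [pow_succ C, Matrix.mul_apply]
      have hXn : IsTraceClassOperator (X ^ (n + 1)) := pow_succ X n ▸ hXtc.mul_left _
      have htr := trace_pow_fin_two (C := C) (p := p) (q := q)
        (by rw [h₁]; simp [C]; ring) (by rw [h₂]; simp [C, hτ, pow_two]; ring) (n + 1)
      have := hC (n + 1)
      simp only [C, Matrix.of_apply] at this
      rw [this, ← htr, Matrix.trace, Finset.sum_mul]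
      exact Finset.sum_congr rfl fun i _ => operatorTrace_smul hXn _
    · intro i; fin_cases i
      exacts [one_mem ℬ, hb]
    · intro i; fin_cases i
      exacts [SMulMemClass.smul_mem c hb, SMulMemClass.smul_mem d (one_mem ℬ)]
    · intro i; fin_cases i
      · simp
      · simp [hcomm]

end Eigenvalues

/-! ### Complex square roots and the four formulas. -/

/-- Valid for every `z`, so the formulas for `p + q` and `p q` need no positivity; positivity
matters only for `p` and `q` to be real. -/
theorem complex_sqrt_mul_self (z : ℂ) : z.sqrt * z.sqrt = z := by
  rw [← pow_two, Complex.sqrt]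
  exact_mod_cast Complex.cpow_nat_inv_pow z two_ne_zero

theorem isSelfAdjoint_complex_sqrt {z : ℂ} (hz : 0 ≤ z) : IsSelfAdjoint z.sqrt := by
  rw [Complex.sqrt_of_nonneg hz]
  exact Complex.conj_ofReal _

end CyclicMonotone

end

theorem theorem2p6 {A : Type*} [Ring A] [StarRing A] [Algebra ℂ A] [StarModule ℂ A]
    (τ : A →ₗ[ℂ] ℂ) (hτ_one : τ 1 = 1) (hτ_tracial : ∀ x y : A, τ (x * y) = τ (y * x))
    (ω : CyclicMonotone.TracialWeight A) {k : ℕ}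
    (a : A) (as : Fin k → A) (b : A) (bs : Fin k → A)
    (𝒜 : NonUnitalStarSubalgebra ℂ A)
    (h𝒜 : 𝒜 = NonUnitalStarAlgebra.adjoin ℂ (insert a (Set.range as)))
    (ℬ : StarSubalgebra ℂ A)
    (hℬ : ℬ = StarAlgebra.adjoin ℂ (insert b (Set.range bs)))
    (htc : CyclicMonotone.IsTraceClassFamily ω (Fin.cons a as : Fin (k + 1) → A))
    (hcm : CyclicMonotone.IsCyclicallyMonotone ω τ 𝒜 ℬ) :
    -- (1)
    (CyclicMonotone.IsTracialOver ω 𝒜 ℬ → (∀ i, IsSelfAdjoint (as i)) →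
      ∀ B : Matrix (Fin k) (Fin k) ℂ, B = Matrix.of (fun i j => τ (star (bs i) * bs j)) →
        CyclicMonotone.IsTraceClass ω (∑ i, bs i * as i * star (bs i)) ∧
        CyclicMonotone.IsTraceClass (ω.matrix k) (CyclicMonotone.sandwich B as) ∧
        CyclicMonotone.EV ω (∑ i, bs i * as i * star (bs i)) =
          CyclicMonotone.EV (ω.matrix k) (CyclicMonotone.sandwich B as)) ∧
    -- (2)
    ((∀ i, IsSelfAdjoint (bs i)) →
      CyclicMonotone.IsTraceClass ω (∑ i, as i * bs i * star (as i)) ∧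
      CyclicMonotone.IsTraceClass ω (∑ i, τ (bs i) • (as i * star (as i))) ∧
      CyclicMonotone.EV ω (∑ i, as i * bs i * star (as i)) =
        CyclicMonotone.EV ω (∑ i, τ (bs i) • (as i * star (as i)))) ∧
    -- (3)
    (IsSelfAdjoint a → IsSelfAdjoint b →
      ∀ p q : ℂ, p = Complex.sqrt (τ (b ^ 2)) + τ b → q = -Complex.sqrt (τ (b ^ 2)) + τ b →
        CyclicMonotone.IsTraceClass ω (a * b + b * a) ∧
        CyclicMonotone.EV ω (a * b + b * a) =
          CyclicMonotone.scaleEV p (CyclicMonotone.EV ω a) +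
            CyclicMonotone.scaleEV q (CyclicMonotone.EV ω a)) ∧
    -- (4)
    (IsSelfAdjoint a → IsSelfAdjoint b →
      ∀ r : ℂ, r = Complex.sqrt (τ (b ^ 2) - τ b ^ 2) →
        CyclicMonotone.IsTraceClass ω (Complex.I • (a * b - b * a)) ∧
        CyclicMonotone.EV ω (Complex.I • (a * b - b * a)) =
          CyclicMonotone.scaleEV r (CyclicMonotone.EV ω a) +
            CyclicMonotone.scaleEV (-r) (CyclicMonotone.EV ω a)) := by
  open CyclicMonotone in
  obtain ⟨Ω, hΩ⟩ := ω.exists_extend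
  obtain ⟨m⟩ := htc
  let S := pairAlgebra (Fin.cons a as : Fin (k + 1) → A) m.x
  have hc𝒜 : ∀ i, (Fin.cons a as : Fin (k + 1) → A) i ∈ 𝒜 := fun i => by
    rw [h𝒜]
    refine NonUnitalStarAlgebra.subset_adjoin ℂ _ ?_
    rw [← Fin.range_cons]
    exact ⟨i, rfl⟩
  have h𝒜dom : ∀ z ∈ 𝒜, z ∈ ω.domain := by
    have : 𝒜 ≤ ω.domain := by
      rw [h𝒜, ← Fin.range_cons]
      refine NonUnitalStarAlgebra.adjoin_le ?_
      rintro _ ⟨i, rfl⟩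
      exact m.mem i
    exact fun z hz => this hz
  have hS : ∀ p ∈ S, p ∈ traceGraph Ω m.H := pairAlgebra_le_traceGraph m.traceClass fun w => by
    rw [← m.same_distribution, ← coe_starWord ω.domain m.mem, hΩ _ (SetLike.coe_mem _)]
  have hmixed := fun p (hp : p ∈ mixedPairs τ S ℬ) =>
    mem_of_mem_mixedPairs hΩ hcm h𝒜dom hS (fst_mem_of_mem_pairAlgebra hc𝒜) hp
  have hT : ∀ p ∈ mixedPairs τ S ℬ, (∀ u ∈ ℬ, u * p.1 ∈ ω.domain) ∧ p ∈ traceGraph Ω m.H :=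
    fun p hp => ⟨fun u hu => hcm.1 _ ((hmixed p hp).1 u hu), (hmixed p hp).2⟩
  have hq : ∀ i, ((Fin.cons a as : Fin (k + 1) → A) i, m.x i) ∈ S := fun i =>
    NonUnitalStarAlgebra.subset_adjoin ℂ _ ⟨i, rfl⟩
  have hqa : (a, m.x 0) ∈ S := hq 0
  have hqs : ∀ i : Fin k, (as i, m.x i.succ) ∈ S := fun i => hq i.succ
  have hbℬ : b ∈ ℬ := hℬ ▸ StarAlgebra.subset_adjoin ℂ _ (Set.mem_insert _ _)
  have hbsℬ : ∀ i, bs i ∈ ℬ := fun i =>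
    hℬ ▸ StarAlgebra.subset_adjoin ℂ _ (Set.mem_insert_of_mem _ ⟨i, rfl⟩)
  have hpos : ∀ i, m.x i ≠ 0 → ∀ y ∈ ℬ, τ (star y) = star (τ y) ∧ 0 ≤ τ (star y * y) :=
    fun i hi y hy => star_and_nonneg_of_ne_zero hτ_one hΩ hT hS (hq i) hi hy
  have hb_real : IsSelfAdjoint b → m.x 0 ≠ 0 →
      IsSelfAdjoint (τ b) ∧ 0 ≤ τ (b ^ 2) ∧ 0 ≤ τ (b ^ 2) - τ b ^ 2 := by
    intro hb h0
    have h1 : IsSelfAdjoint (τ b) := by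
      have := (hpos 0 h0 b hbℬ).1
      rw [hb.star_eq] at this
      exact this.symm
    refine ⟨h1, ?_, ?_⟩
    · simpa [hb.star_eq, pow_two] using (hpos 0 h0 b hbℬ).2
    -- The variance: `τ` is positive at `b - τ(b) 1`.
    · have h2 := (hpos 0 h0 (b - τ b • 1)
        (sub_mem hbℬ (SMulMemClass.smul_mem _ (one_mem ℬ)))).2
      rw [star_sub, star_smul, star_one, hb.star_eq, h1.star_eq] at h2
      convert h2 using 1
      simp [mul_sub, sub_mul, hτ_one, pow_two]
  refine ⟨fun htr hsa B hB => ?_, fun hsa => ?_, fun ha hb p q hp hq' => ?_,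
    fun ha hb r hr => ?_⟩
  · refine isTraceClass_and_EV_sum_conj hτ_one hΩ hT hS hqs hbsℬ hsa (fun i => ?_) hB ?_
    · have h1 := mk_mem_mixedPairs (τ := τ) (hqs i) (star_mem (hbsℬ i))
      have h2 := mk_mem_mixedPairs (τ := τ) (hqs i) (mul_mem (star_mem (hbsℬ i)) (hbsℬ i))
      have h3 : as i * star (bs i) * bs i ∈ ω.domain := by
        simpa [mul_assoc] using (hT _ h2).1 1 (one_mem ℬ)
      have h4 : bs i * (as i * star (bs i)) ∈ ω.domain := (hT _ h1).1 _ (hbsℬ i)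
      have h5 := htr (as i * star (bs i)) (by simpa using (hmixed _ h1).1 1 (one_mem ℬ)) (bs i)
        (hbsℬ i) h3 h4
      rw [← hΩ, ← hΩ, mul_assoc] at h5
      exact h5.symm
    -- A single nonzero `Xⱼ` makes `τ` positive on all of `ℬ`; then `B` is a Gram matrix, with `c* B
    -- c = τ(y* y)` for `y = ∑ cᵢ bᵢ`.
    · by_cases h0 : ∀ i : Fin k, m.x i.succ = 0
      · exact .inl h0
      · right
        push Not at h0
        obtain ⟨j, hj⟩ := h0
        rw [Matrix.nonneg_iff_posSemidef, hB]
        refine Matrix.PosSemidef.of_dotProduct_mulVec_nonneg ?_ fun c => ?_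
        · ext i l
          have := (hpos _ hj (star (bs l) * bs i) (mul_mem (star_mem (hbsℬ l)) (hbsℬ i))).1
          rw [star_mul, star_star] at this
          simp [this]
        · have := (hpos _ hj (∑ i, c i • bs i)
            (sum_mem fun i _ => SMulMemClass.smul_mem _ (hbsℬ i))).2
          have e : star (∑ i, c i • bs i) * ∑ i, c i • bs i =
              ∑ i, ∑ l, (star (c i) * c l) • (star (bs i) * bs l) := by
            rw [star_sum, Finset.sum_mul_sum]
            simp only [star_smul, smul_mul_smul_comm]
          rw [e] at this
          convert this using 1
          simp only [map_sum, map_smul, dotProduct, Matrix.mulVec, Matrix.of_apply, Finset.mul_sum,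
            Pi.star_apply, smul_eq_mul]
          exact Finset.sum_congr rfl fun i _ => Finset.sum_congr rfl fun l _ => by ring
  · refine isTraceClass_and_EV_sum_mul_mul_star hτ_one hΩ hT hS hqs hbsℬ hsa ?_
    by_cases h0 : ∀ i : Fin k, m.x i.succ = 0
    · exact .inl h0
    · right
      push Not at h0
      obtain ⟨j, hj⟩ := h0
      intro i
      have := (hpos _ hj (bs i) (hbsℬ i)).1
      rw [(hsa i).star_eq] at this
      exact this.symm
  · have key := isTraceClass_and_EV_add (c := 1) (d := 1) (p := p) (q := q) hτ_one hΩ hT hS hqa hbℬ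
      ha hb (or_iff_not_imp_left.2 fun h => (hb_real hb h).1) (star_one _)
      (by rw [hp, hq']; ring)
      (by rw [hp, hq']; linear_combination -complex_sqrt_mul_self (τ (b ^ 2)))
      (or_iff_not_imp_left.2 fun h => by
        obtain ⟨h1, h2, -⟩ := hb_real hb h
        rw [hp, hq']
        exact ⟨(isSelfAdjoint_complex_sqrt h2).add h1, (isSelfAdjoint_complex_sqrt h2).neg.add h1⟩)
    simpa only [one_smul] using key
  · have key := isTraceClass_and_EV_add (c := Complex.I) (d := -Complex.I) (p := r) (q := -r)
      hτ_one hΩ hT hS hqa hbℬ ha hb (or_iff_not_imp_left.2 fun h => (hb_real hb h).1)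
      Complex.conj_I (by ring)
      (by
        rw [hr]
        linear_combination -complex_sqrt_mul_self (τ (b ^ 2) - τ b ^ 2) +
          (τ b ^ 2 - τ (b ^ 2)) * Complex.I_mul_I)
      (or_iff_not_imp_left.2 fun h => by
        rw [hr]
        have := isSelfAdjoint_complex_sqrt (hb_real hb h).2.2
        exact ⟨this, this.neg⟩)
    rwa [neg_smul, ← sub_eq_add_neg, ← smul_sub] at key
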